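/- Let $(M,g)$ be a compact smooth Riemannian manifold of dimension $n$ (without boundary), $\mathcal B=C^\infty(M,\mathbb C)$, let $\Omega^1=\Omega^1(M)\otimes\mathbb C$ be the smooth complex one-forms, $\mathrm d:\mathcal B\to\Omega^1$ the exterior derivative, and $T^k=(\Omega^1)^{\otimes_{\mathcal B}k}$. Put $\eta^\dagger=-\overline{\eta}$ on $\Omega^1$ (so $(\mathrm dx)^\dagger=-\mathrm dx$), $(\eta\otimes\xi)^\dagger=\xi^\dagger\otimes\eta^\dagger$, and $\langle\eta|\xi\rangle=g^{\mu\nu}\overline{\eta_\mu}\,\xi_\nu\in\mathcal B$, extended by $\langle\eta|\xi\otimes\rho\rangle=\langle\eta|\xi\rangle\rho$ and $\langle\xi\otimes\rho|\eta\rangle=\rho^\dagger\langle\xi|\eta\rangle$. Let $\sigma(\eta\otimes\xi)=\xi\otimes\eta$, $\Psi=\frac12(1+\sigma)$, and $P=\Psi\otimes1$, $Q=1\otimes\Psi$ on $T^3$. The derivative of one-forms is $\mathrm d\big(\sum_i a_i\,\mathrm db_i\big)=(1-\Psi)\big(\sum_i\mathrm da_i\otimes\mathrm db_i\big)\in T^2$,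 for $\sum_i a_i\otimes b_i$ in the kernel of the multiplication $\mathcal B\otimes_{\mathbb C}\mathcal B\to\mathcal B$. For $t\in T^2$ and $\xi,\eta\in\Omega^1$ put $\overrightarrow\alpha(t\otimes\xi)(\eta)=t\,\langle\xi^\dagger|\eta\rangle$. Let $(\varphi_\alpha)$ be a finite smooth partition of unity with smooth square roots, subordinate to coordinate charts $(U_\alpha,x_\alpha)$, and on each $U_\alpha$ let $e^j=\sum_\mu B^j_\mu\,\mathrm dx^\mu$ ($1\le j\le n$) be an orthonormal coframe with smooth real coefficients $B^j_\mu$ (which depend on $\alpha$). Put $\omega_{j\alpha}=\sqrt{\varphi_\alpha}\,e^j\in\Omega^1$ and $$\overrightarrow\nabla^v(\eta)=\sum_{j,\alpha}\omega_{j\alpha}\otimes\mathrm d\langle\omega_{j\alpha}|\eta\rangle,\qquad W=\sum_{j,\alpha}\mathrm d(\omega_{j\alpha})\otimes\omega_{j\alpha}^\dagger,\qquad A=(1+4PQ)(W).$$ Elements of $T^2$ and $T^3$ are determined by their values at the points of $M$, the $\omega_{j\alpha}$ form a frame, that is, $\eta=\sum_{j,\alpha}\omega_{j\alpha}\langle\omega_{j\alpha}|\eta\rangle$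 for all $\eta\in\Omega^1$, and the following hold. 1. With the coordinates of $U_\alpha$ in the $\alpha$-th term (which vanishes off $U_\alpha$), and ${}_{,\mu}$ the partial derivatives, $$A=\sum_\alpha\varphi_\alpha\sum_{\rho,\mu,\sigma}\Big(\tfrac12\big(-g_{\mu\rho,\sigma}+g_{\rho\sigma,\mu}+g_{\sigma\mu,\rho}\big)-\sum_jB^j_{\rho,\mu}B^j_\sigma\Big)\,\mathrm dx^\rho\otimes\mathrm dx^\mu\otimes(\mathrm dx^\sigma)^\dagger .$$ 2. $\overrightarrow\nabla^v-\overrightarrow\alpha(A)$ is the unique $\mathbb C$-linear map $\nabla:\Omega^1\to T^2$ with $\nabla(\eta b)=\nabla(\eta)b+\eta\otimes\mathrm db$ that is Hermitian, $\mathrm d\langle\eta|\xi\rangle=\langle\eta|\nabla\xi\rangle-\langle\nabla\eta|\xi\rangle$, torsion-free, $(1-\Psi)\nabla+\mathrm d=0$, and a $\dagger$-bimodule connection, $\sigma\circ\nabla=-\dagger\circ\nabla\circ\dagger$. So $A$ is the connection form of the Levi-Civita connection in the frame $(\omega_{j\alpha})$. 3. For every coordinate chart $(U,x)$ of $M$ and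 every $\eta\in\Omega^1$, with $\eta=\sum_\nu f_\nu\,\mathrm dx^\nu$ on $U$ (in particular for $\eta$ supported in $U$), one has on $U$ $$\overrightarrow\nabla^v(\eta)-\overrightarrow\alpha\big((1+4PQ)(W)\big)(\eta)=\sum_{\nu,\rho}f_{\nu,\rho}\,\mathrm dx^\nu\otimes\mathrm dx^\rho-\sum_{\nu,\mu,\rho}f_\nu\,\Gamma^\nu_{\mu\rho}\,\mathrm dx^\rho\otimes\mathrm dx^\mu,$$ where $\Gamma^\nu_{\mu\rho}=\frac12\sum_\sigma g^{\nu\sigma}(g_{\sigma\rho,\mu}+g_{\sigma\mu,\rho}-g_{\mu\rho,\sigma})$ are the Christoffel symbols of $g$. 4. This is the classical Levi-Civita connection on one-forms: if $\nabla^{LC}$ is the torsion-free metric covariant derivative on $TM$, then at each point, contracting the first tensor factor with $X$ and the second with $Y$, $$\big(\overrightarrow\nabla^v\eta-\overrightarrow\alpha(A)\eta\big)(X,Y)=Y\big(\eta(X)\big)-\eta\big(\nabla^{LC}_YX\big)$$ for all $\eta\in\Omega^1$, all vector fields $X$ differentiable at the point and all tangent vectors $Y$ there. -/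

import Mathlib

open scoped Manifold ContDiff TensorProduct Bundle ComplexConjugate

noncomputable section

namespace RiemannianCalculus

/-! ## Smooth functions and smooth complex one-forms -/

section Forms

variable (n : ℕ) (M : Type*) [TopologicalSpace M] [ChartedSpace (EuclideanSpace ℝ (Fin n)) M]

/-- The `*`-algebra `C^∞(M, ℂ)`, as a star subalgebra of all functions `M → ℂ`. -/
def smoothFunctions : StarSubalgebra ℂ (M → ℂ) where
  carrier := {f | ContMDiff (𝓡 n) 𝓘(ℝ, ℂ) ∞ f}
  mul_mem' {f g} hf hg x := by
    have h := ((contDiff_mul (𝕜 := ℝ) (𝔸 := ℂ) (n := ∞)).contMDiff (x := (f x, g x))).comp x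
      ((hf x).prodMk_space (hg x))
    exact h
  add_mem' {f g} hf hg := ContMDiff.add hf hg
  algebraMap_mem' c := contMDiff_const
  star_mem' {f} hf := (Complex.conjCLE.contDiff.contMDiff).comp hf

/-- `C^∞(M, ℂ)` as a type. -/
def SmoothFun : Type _ := smoothFunctions n M

instance : CommRing (SmoothFun n M) := inferInstanceAs (CommRing (smoothFunctions n M))
instance : Algebra ℂ (SmoothFun n M) := inferInstanceAs (Algebra ℂ (smoothFunctions n M))
instance : StarRing (SmoothFun n M) := inferInstanceAs (StarRing (smoothFunctions n M))
instance : CoeFun (SmoothFun n M) (fun _ => M → ℂ) := ⟨Subtype.val⟩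

variable {n M}

/-- Evaluation of a function at a point, as a ring homomorphism. -/
def evalFun (x : M) : SmoothFun n M →+* ℂ :=
  (Pi.evalRingHom (fun _ : M => ℂ) x).comp (smoothFunctions n M).subtype.toAlgHom.toRingHom

variable (n)

/-- The complexified cotangent space `T_x^*M ⊗ ℂ`, i.e. real-linear maps `T_x M → ℂ`. -/
abbrev CotC (x : M) : Type := TangentSpace (𝓡 n) x →L[ℝ] ℂ

variable {n}

/-- Products of smooth complex functions are smooth. -/
theorem contMDiffAt_mul {f g : M → ℂ} {x₀ : M} (hf : ContMDiffAt (𝓡 n) 𝓘(ℝ, ℂ) ∞ f x₀)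
    (hg : ContMDiffAt (𝓡 n) 𝓘(ℝ, ℂ) ∞ g x₀) :
    ContMDiffAt (𝓡 n) 𝓘(ℝ, ℂ) ∞ (fun x => f x * g x) x₀ :=
  ((contDiff_mul (𝕜 := ℝ) (𝔸 := ℂ) (n := ∞)).contMDiff (x := (_, _))).comp x₀ (hf.prodMk_space hg)

/-- The entries of the inverse of a smooth invertible matrix are smooth. -/
theorem contMDiffAt_matrix_inv {G : M → Matrix (Fin n) (Fin n) ℝ} {x₀ : M}
    (hG : ∀ i j, ContMDiffAt (𝓡 n) 𝓘(ℝ, ℝ) ∞ (fun x => G x i j) x₀)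
    (hdet : (G x₀).det ≠ 0) (i j : Fin n) :
    ContMDiffAt (𝓡 n) 𝓘(ℝ, ℝ) ∞ (fun x => (G x)⁻¹ i j) x₀ := by
  have hd : ContDiff ℝ ∞ (fun A : Fin n → Fin n → ℝ => (Matrix.of A).det) := by
    simp only [Matrix.det_apply, Matrix.of_apply]
    fun_prop
  have hGc : ContMDiffAt (𝓡 n) 𝓘(ℝ, Fin n → Fin n → ℝ) ∞ (fun x => fun i j => G x i j) x₀ :=
    contMDiffAt_pi_space.2 fun i => contMDiffAt_pi_space.2 fun j => hG i j
  have ha : ContDiff ℝ ∞ (fun A : Fin n → Fin n → ℝ => (Matrix.of A).adjugate i j) := by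
    simp only [Matrix.adjugate_apply]
    have h2 : ContDiff ℝ ∞ (fun A : Fin n → Fin n → ℝ => fun k l =>
        (Matrix.updateRow (Matrix.of A) j (Pi.single i 1)) k l) := by
      refine contDiff_pi.2 fun k => contDiff_pi.2 fun l => ?_
      by_cases h : k = j
      · subst h
        simpa using contDiff_const
      · simp only [Matrix.updateRow_ne h, Matrix.of_apply]
        fun_prop
    exact hd.comp h2
  have h1 : ContDiffAt ℝ ∞ (fun A : Fin n → Fin n → ℝ => (Matrix.of A)⁻¹ i j)
      (fun i j => G x₀ i j) := by
    simp only [Matrix.inv_def, Ring.inverse_eq_inv', Matrix.smul_apply, smul_eq_mul]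
    exact (hd.contDiffAt.inv hdet).mul ha.contDiffAt
  exact h1.contMDiffAt.comp x₀ hGc

variable [IsManifold (𝓡 n) ∞ M]

/-- Smoothness at a point of a section of the bundle `Hom_ℝ(TM, ℂ) = T^*M ⊗ ℂ`. -/
def IsSmoothFormAt (η : ∀ x : M, CotC n x) (x₀ : M) : Prop :=
  ContMDiffAt (𝓡 n) ((𝓡 n).prod 𝓘(ℝ, EuclideanSpace ℝ (Fin n) →L[ℝ] ℂ)) ∞
    (fun x => Bundle.TotalSpace.mk' (EuclideanSpace ℝ (Fin n) →L[ℝ] ℂ)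
      (E := fun x : M => TangentSpace (𝓡 n) x →L[ℝ] Bundle.Trivial M ℂ x) x (η x)) x₀

/-- Smoothness of a form read in a local trivialisation of the tangent bundle. -/
theorem isSmoothFormAt_iff (η : ∀ x : M, CotC n x) (x₀ : M) :
    IsSmoothFormAt η x₀ ↔ ContMDiffAt (𝓡 n) 𝓘(ℝ, EuclideanSpace ℝ (Fin n) →L[ℝ] ℂ) ∞
      (fun x => (η x).comp ((trivializationAt (EuclideanSpace ℝ (Fin n))
          (TangentSpace (𝓡 n) : M → Type _) x₀).symmL ℝ x)) x₀ := by
  unfold IsSmoothFormAt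
  rw [contMDiffAt_hom_bundle]
  have h : ContMDiffAt (𝓡 n) (𝓡 n) ∞ (fun x : M => x) x₀ := contMDiffAt_id
  simp only [h, true_and]
  apply iff_of_eq
  congr 1
  ext
  simp [ContinuousLinearMap.inCoordinates]

theorem IsSmoothFormAt.add {η ξ : ∀ x : M, CotC n x} {x₀ : M}
    (hη : IsSmoothFormAt η x₀) (hξ : IsSmoothFormAt ξ x₀) :
    IsSmoothFormAt (fun x => η x + ξ x) x₀ := by
  rw [isSmoothFormAt_iff] at *
  exact hη.add hξ

theorem IsSmoothFormAt.congr_eventually {η ξ : ∀ x : M, CotC n x} {x₀ : M}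
    (hη : IsSmoothFormAt η x₀) (h : ∀ᶠ x in nhds x₀, ξ x = η x) : IsSmoothFormAt ξ x₀ :=
  ContMDiffAt.congr_of_eventuallyEq hη (h.mono fun x hx => by simp [hx])

theorem isSmoothFormAt_zero (x₀ : M) : IsSmoothFormAt (fun x : M => (0 : CotC n x)) x₀ := by
  rw [isSmoothFormAt_iff]
  exact contMDiffAt_const (c := (0 : EuclideanSpace ℝ (Fin n) →L[ℝ] ℂ))

theorem IsSmoothFormAt.smul {f : M → ℂ} {η : ∀ x : M, CotC n x} {x₀ : M}
    (hf : ContMDiffAt (𝓡 n) 𝓘(ℝ, ℂ) ∞ f x₀) (hη : IsSmoothFormAt η x₀) :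
    IsSmoothFormAt (fun x => f x • η x) x₀ := by
  rw [isSmoothFormAt_iff] at *
  have h1 : ContDiff ℝ ∞ (fun p : ℂ × (EuclideanSpace ℝ (Fin n) →L[ℝ] ℂ) => p.1 • p.2) :=
    contDiff_smul
  exact (h1.contMDiff (x := (_, _))).comp x₀ (hf.prodMk_space hη)

theorem IsSmoothFormAt.sum {κ : Type*} {s : Finset κ} {η : κ → ∀ x : M, CotC n x} {x₀ : M}
    (hη : ∀ i ∈ s, IsSmoothFormAt (η i) x₀) :
    IsSmoothFormAt (fun x => ∑ i ∈ s, η i x) x₀ := by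
  classical
  induction s using Finset.induction_on with
  | empty => simpa using isSmoothFormAt_zero x₀
  | insert a s ha ih =>
    simp only [Finset.sum_insert ha]
    exact (hη a (by simp)).add (ih fun i hi => hη i (by simp [hi]))

/-- Post-composition of a form with a real-linear map of `ℂ`. -/
theorem IsSmoothFormAt.clm_comp (L : ℂ →L[ℝ] ℂ) {η : ∀ x : M, CotC n x} {x₀ : M}
    (hη : IsSmoothFormAt η x₀) : IsSmoothFormAt (fun x => L.comp (η x)) x₀ := by
  rw [isSmoothFormAt_iff] at *
  exact (((ContinuousLinearMap.compL ℝ (EuclideanSpace ℝ (Fin n)) ℂ ℂ L).contDiff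
    (n := ∞)).contMDiff.contMDiffAt).comp x₀ hη

theorem isSmoothFormAt_mvfderiv {f : M → ℂ} {x₀ : M} (hf : ContMDiffAt (𝓡 n) 𝓘(ℝ, ℂ) ∞ f x₀) :
    IsSmoothFormAt (fun x => (mvfderiv (𝓡 n) f x : CotC n x)) x₀ := by
  rw [isSmoothFormAt_iff]
  have h := hf.mfderiv_const (m := ∞) (by simp)
  refine h.congr_of_eventuallyEq (Filter.Eventually.of_forall fun x => ?_)
  ext v
  simp [inTangentCoordinates, ContinuousLinearMap.inCoordinates]
  rfl

variable (n M)

/-- The space `Ω¹(M) ⊗ ℂ` of smooth complex one-forms. -/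
@[ext]
structure OneForm where
  val : ∀ x : M, CotC n x
  smooth : ∀ x₀, IsSmoothFormAt val x₀

variable {n M}

namespace OneForm

instance : CoeFun (OneForm n M) (fun _ => ∀ x : M, CotC n x) := ⟨OneForm.val⟩

instance : Zero (OneForm n M) := ⟨⟨fun _ => 0, isSmoothFormAt_zero⟩⟩
instance : Add (OneForm n M) :=
  ⟨fun η ξ => ⟨fun x => η x + ξ x, fun x => (η.smooth x).add (ξ.smooth x)⟩⟩
instance : SMul (SmoothFun n M) (OneForm n M) :=
  ⟨fun f η => ⟨fun x => f x • η x, fun x => (η.smooth x).smul (f.2 x)⟩⟩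
instance : SMul ℂ (OneForm n M) :=
  ⟨fun c η => ⟨fun x => c • η x, fun x => (η.smooth x).smul contMDiffAt_const⟩⟩
instance : Neg (OneForm n M) :=
  ⟨fun η => ⟨fun x => -η x, fun x => by
    have h := (η.smooth x).clm_comp (-ContinuousLinearMap.id ℝ ℂ)
    simp only [ContinuousLinearMap.neg_comp, ContinuousLinearMap.id_comp] at h
    exact h⟩⟩

@[simp] theorem add_apply (η ξ : OneForm n M) (x : M) : (η + ξ) x = η x + ξ x := rfl
@[simp] theorem neg_apply (η : OneForm n M) (x : M) : (-η) x = -η x := rfl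
@[simp] theorem zero_apply (x : M) : (0 : OneForm n M) x = 0 := rfl
@[simp] theorem smul_apply (f : SmoothFun n M) (η : OneForm n M) (x : M) :
    (f • η) x = f x • η x := rfl
@[simp] theorem csmul_apply (c : ℂ) (η : OneForm n M) (x : M) : (c • η) x = c • η x := rfl

theorem ext_apply {η ξ : OneForm n M} (h : ∀ x, η x = ξ x) : η = ξ := OneForm.ext (funext h)

instance : AddCommGroup (OneForm n M) where
  add_assoc _ _ _ := ext_apply fun _ => add_assoc _ _ _
  zero_add _ := ext_apply fun _ => zero_add _
  add_zero _ := ext_apply fun _ => add_zero _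
  add_comm _ _ := ext_apply fun _ => add_comm _ _
  neg_add_cancel _ := ext_apply fun _ => neg_add_cancel _
  nsmul := nsmulRec
  zsmul := zsmulRec

instance : Module (SmoothFun n M) (OneForm n M) where
  one_smul η := ext_apply fun x => one_smul ℂ (η x)
  mul_smul f g η := ext_apply fun x => mul_smul (f x) (g x) (η x)
  smul_zero f := ext_apply fun x => smul_zero (A := CotC n x) (f x)
  smul_add f η ξ := ext_apply fun x => smul_add (f x) (η x) (ξ x)
  add_smul f g η := ext_apply fun x => add_smul (f x) (g x) (η x)
  zero_smul η := ext_apply fun x => zero_smul ℂ (η x)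

instance : Module ℂ (OneForm n M) where
  one_smul η := ext_apply fun x => one_smul ℂ (η x)
  mul_smul f g η := ext_apply fun x => mul_smul f g (η x)
  smul_zero f := ext_apply fun x => smul_zero (A := CotC n x) f
  smul_add f η ξ := ext_apply fun x => smul_add f (η x) (ξ x)
  add_smul f g η := ext_apply fun x => add_smul f g (η x)
  zero_smul η := ext_apply fun x => zero_smul ℂ (η x)

instance : IsScalarTower ℂ (SmoothFun n M) (OneForm n M) :=
  ⟨fun c f η => ext_apply fun x => mul_smul c (f x) (η x)⟩

end OneForm

/-- The exterior derivative on functions, `d : C^∞(M, ℂ) → Ω¹(M) ⊗ ℂ`. -/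
def dFun : SmoothFun n M →ₗ[ℂ] OneForm n M where
  toFun f := ⟨fun x => mvfderiv (𝓡 n) f x, fun x => isSmoothFormAt_mvfderiv (f.2 x)⟩
  map_add' f g := OneForm.ext_apply fun x =>
    mvfderiv_add ((f.2 x).mdifferentiableAt (by simp)) ((g.2 x).mdifferentiableAt (by simp))
  map_smul' c f := OneForm.ext_apply fun x => by
    have hf : MDifferentiableAt (𝓡 n) 𝓘(ℝ, ℂ) f x := (f.2 x).mdifferentiableAt (by simp)
    have hL : HasMFDerivAt 𝓘(ℝ, ℂ) 𝓘(ℝ, ℂ) (c • ContinuousLinearMap.id ℝ ℂ) (f x)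
      (c • ContinuousLinearMap.id ℝ ℂ) := ContinuousLinearMap.hasMFDerivAt _
    have h := (hL.comp x hf.hasMFDerivAt).mfderiv
    ext v
    exact congrArg (fun T => T v) h

/-- The involution `†` on `T_x^*M ⊗ ℂ`: minus complex conjugation, so that `(dx)^† = -dx`. -/
def cotDagger {x : M} (η : CotC n x) : CotC n x := -((Complex.conjCLE : ℂ →L[ℝ] ℂ).comp η)

/-- The involution `†` on `Ω¹(M) ⊗ ℂ`; it is conjugate-linear over `C^∞(M, ℂ)`. -/
def dagger : OneForm n M →ₛₗ[starRingEnd (SmoothFun n M)] OneForm n M where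
  toFun η := ⟨fun x => cotDagger (η x), fun x => by
    have h := (η.smooth x).clm_comp (-(Complex.conjCLE : ℂ →L[ℝ] ℂ))
    simp only [ContinuousLinearMap.neg_comp] at h
    exact h⟩
  map_add' η ξ := OneForm.ext_apply fun x => by
    ext v; simp [cotDagger]; ring
  map_smul' f η := OneForm.ext_apply fun x => by
    ext v
    have : (starRingEnd (SmoothFun n M) f) x = conj (f x) := rfl
    simp [cotDagger, this]

end Forms

/-! ## The Riemannian inner product of one-forms -/

section Metric

variable {n : ℕ} {M : Type*} [TopologicalSpace M] [ChartedSpace (EuclideanSpace ℝ (Fin n)) M]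
  [IsManifold (𝓡 n) ∞ M] [Bundle.RiemannianBundle (fun x : M => TangentSpace (𝓡 n) x)]

instance (x : M) : FiniteDimensional ℝ (TangentSpace (𝓡 n) x) :=
  inferInstanceAs (FiniteDimensional ℝ (EuclideanSpace ℝ (Fin n)))

/-- The Hermitian inner product `⟨η | ξ⟩_x = g^{μν} conj(η_μ) ξ_ν` on `T_x^*M ⊗ ℂ`, linear in the
second variable, computed in an orthonormal basis of `T_x M`. -/
def cotInner {x : M} (η ξ : CotC n x) : ℂ :=
  ∑ i, conj (η (stdOrthonormalBasis ℝ (TangentSpace (𝓡 n) x) i)) *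
    ξ (stdOrthonormalBasis ℝ (TangentSpace (𝓡 n) x) i)

theorem sum_gram_inv {V : Type*} [NormedAddCommGroup V] [InnerProductSpace ℝ V] {κ : Type*}
    [Fintype κ] (b : OrthonormalBasis κ ℝ V) (v : Module.Basis (Fin n) ℝ V)
    (η ξ : V →L[ℝ] ℂ) :
    ∑ k, conj (η (b k)) * ξ (b k) = ∑ i, ∑ j,
      (((Matrix.of fun i j => inner ℝ (v i) (v j))⁻¹ i j : ℝ) : ℂ) * (conj (η (v i)) * ξ (v j)) := by
  classical
  set S := v.toMatrix b
  set T := b.toBasis.toMatrix v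
  have hST : S * T = 1 := by
    have := v.toMatrix_mul_toMatrix_flip b.toBasis
    simpa using this
  have hTS : T * S = 1 := by
    have h := b.toBasis.toMatrix_mul_toMatrix_flip v
    rw [OrthonormalBasis.coe_toBasis] at h
    exact h
  have hG : (Matrix.of fun i j => inner ℝ (v i) (v j)) = T.transpose * T := by
    ext i j
    simp only [Matrix.of_apply, Matrix.mul_apply, Matrix.transpose_apply, T, Module.Basis.toMatrix_apply]
    rw [← b.sum_inner_mul_inner (v i) (v j)]
    simp [real_inner_comm, OrthonormalBasis.repr_apply_apply]
  have hinv : (Matrix.of fun i j => inner ℝ (v i) (v j))⁻¹ = S * S.transpose := by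
    apply Matrix.inv_eq_left_inv
    rw [hG, Matrix.mul_assoc, ← Matrix.mul_assoc S.transpose, ← Matrix.transpose_mul, hTS]
    simp [hST]
  have hb : ∀ k, b k = ∑ i, S i k • v i := fun k => by
    simp only [S, Module.Basis.toMatrix_apply]
    exact (v.sum_repr (b k)).symm
  rw [hinv]
  simp only [Matrix.mul_apply, Matrix.transpose_apply]
  simp_rw [hb, map_sum, map_smul, Finset.sum_mul_sum]
  push_cast
  simp_rw [Finset.sum_mul]
  rw [Finset.sum_comm]
  refine Finset.sum_congr rfl fun i _ => ?_
  rw [Finset.sum_comm]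
  refine Finset.sum_congr rfl fun j _ => Finset.sum_congr rfl fun k _ => ?_
  simp
  ring

variable [IsContMDiffRiemannianBundle (𝓡 n) ∞ (EuclideanSpace ℝ (Fin n))
  (fun x : M => TangentSpace (𝓡 n) x)]

theorem contMDiff_cotInner (η ξ : OneForm n M) :
    ContMDiff (𝓡 n) 𝓘(ℝ, ℂ) ∞ (fun x => cotInner (η x) (ξ x)) := by
  intro x₀
  set e := trivializationAt (EuclideanSpace ℝ (Fin n)) (TangentSpace (𝓡 n) : M → Type _) x₀
  set b := EuclideanSpace.basisFun (Fin n) ℝ |>.toBasis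
  have hx₀ : x₀ ∈ e.baseSet := FiberBundle.mem_baseSet_trivializationAt' x₀
  have hs : ∀ i, ContMDiffAt (𝓡 n) ((𝓡 n).prod 𝓘(ℝ, EuclideanSpace ℝ (Fin n))) ∞
      (fun x => Bundle.TotalSpace.mk' (EuclideanSpace ℝ (Fin n)) x (e.localFrame b i x)) x₀ :=
    fun i => contMDiffAt_localFrame_of_mem ∞ e b i hx₀
  have hform : ∀ (θ : OneForm n M) (i : Fin n),
      ContMDiffAt (𝓡 n) 𝓘(ℝ, ℂ) ∞ (fun x => θ x (e.localFrame b i x)) x₀ := by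
    intro θ i
    have h := (isSmoothFormAt_iff θ x₀).1 (θ.smooth x₀)
    have h2 : ContMDiffAt (𝓡 n) 𝓘(ℝ, ℂ) ∞ (fun x => ((θ x).comp (e.symmL ℝ x)) (b i)) x₀ :=
      h.clm_apply contMDiffAt_const
    refine h2.congr_of_eventuallyEq ?_
    filter_upwards [e.open_baseSet.mem_nhds hx₀] with x hx
    rw [e.localFrame_apply_of_mem_baseSet b hx]
    simp [Bundle.Trivialization.basisAt, Bundle.Trivialization.symmL_apply, hx]
  have hG : ∀ i j, ContMDiffAt (𝓡 n) 𝓘(ℝ, ℝ) ∞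
      (fun x => (Matrix.of fun i j => inner ℝ (e.localFrame b i x) (e.localFrame b j x)) i j) x₀ :=
    fun i j => ContMDiffAt.inner_bundle (IB := 𝓡 n) (hs i) (hs j)
  have hdet : (Matrix.of fun i j =>
      inner ℝ (e.localFrame b i x₀) (e.localFrame b j x₀)).det ≠ 0 := by
    have h : (Matrix.of fun i j => inner ℝ (e.localFrame b i x₀) (e.localFrame b j x₀)) =
        Matrix.gram ℝ (e.basisAt b hx₀) := by
      ext i j
      simp [e.localFrame_apply_of_mem_baseSet b hx₀, Matrix.gram]
    rw [h]
    exact (Matrix.posDef_gram_of_linearIndependent (e.basisAt b hx₀).linearIndependent).det_pos.ne'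
  have hsum : ContMDiffAt (𝓡 n) 𝓘(ℝ, ℂ) ∞ (fun x => ∑ i, ∑ j,
      (((Matrix.of fun i j => inner ℝ (e.localFrame b i x) (e.localFrame b j x))⁻¹ i j : ℝ) : ℂ) *
        (conj (η x (e.localFrame b i x)) * ξ x (e.localFrame b j x))) x₀ := by
    refine ContMDiffAt.sum fun i _ => ContMDiffAt.sum fun j _ => ?_
    have h1 : ContMDiffAt (𝓡 n) 𝓘(ℝ, ℂ) ∞ (fun x => (((Matrix.of fun i j =>
        inner ℝ (e.localFrame b i x) (e.localFrame b j x))⁻¹ i j : ℝ) : ℂ)) x₀ :=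
      Complex.ofRealCLM.contDiff.contMDiff.contMDiffAt.comp x₀ (contMDiffAt_matrix_inv hG hdet i j)
    have h2 : ContMDiffAt (𝓡 n) 𝓘(ℝ, ℂ) ∞ (fun x => conj (η x (e.localFrame b i x))) x₀ :=
      Complex.conjCLE.contDiff.contMDiff.contMDiffAt.comp x₀ (hform η i)
    exact contMDiffAt_mul h1 (contMDiffAt_mul h2 (hform ξ j))
  refine hsum.congr_of_eventuallyEq ?_
  filter_upwards [e.open_baseSet.mem_nhds hx₀] with x hx
  have h := sum_gram_inv (stdOrthonormalBasis ℝ (TangentSpace (𝓡 n) x)) (e.basisAt b hx) (η x) (ξ x)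
  simp only [e.localFrame_apply_of_mem_baseSet b hx]
  exact h

/-- The `C^∞(M, ℂ)`-valued inner product `⟨η | ξ⟩` of one-forms, linear in the second variable. -/
def pairing : OneForm n M →ₛₗ[starRingEnd (SmoothFun n M)] OneForm n M →ₗ[SmoothFun n M]
    SmoothFun n M :=
  LinearMap.mk₂'ₛₗ _ _ (fun η ξ => ⟨fun x => cotInner (η x) (ξ x), contMDiff_cotInner η ξ⟩)
    (fun η₁ η₂ ξ => Subtype.ext <| funext fun x => by
      change cotInner (η₁ x + η₂ x) (ξ x) = cotInner (η₁ x) (ξ x) + cotInner (η₂ x) (ξ x)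
      simp [cotInner, add_mul, Finset.sum_add_distrib])
    (fun f η ξ => Subtype.ext <| funext fun x => by
      change cotInner (f x • η x) (ξ x) = conj (f x) * cotInner (η x) (ξ x)
      simp [cotInner, mul_assoc, Finset.mul_sum])
    (fun η ξ₁ ξ₂ => Subtype.ext <| funext fun x => by
      change cotInner (η x) (ξ₁ x + ξ₂ x) = cotInner (η x) (ξ₁ x) + cotInner (η x) (ξ₂ x)
      simp [cotInner, mul_add, Finset.sum_add_distrib])
    (fun f η ξ => Subtype.ext <| funext fun x => by
      change cotInner (η x) (f x • ξ x) = f x * cotInner (η x) (ξ x)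
      simp [cotInner, mul_left_comm, Finset.mul_sum])

end Metric

/-! ## The tensor algebra of the calculus -/

section Tensor

variable (n : ℕ) (M : Type*) [TopologicalSpace M] [ChartedSpace (EuclideanSpace ℝ (Fin n)) M]
  [IsManifold (𝓡 n) ∞ M]

/-- Two-tensors `T² = Ω¹ ⊗_B Ω¹`, with `B = C^∞(M, ℂ)`. -/
abbrev T2 : Type _ := OneForm n M ⊗[SmoothFun n M] OneForm n M

/-- Three-tensors `T³ = Ω¹ ⊗_B Ω¹ ⊗_B Ω¹`. -/
abbrev T3 : Type _ := T2 n M ⊗[SmoothFun n M] OneForm n M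

/-- The flip `σ(η ⊗ ξ) = ξ ⊗ η`. -/
def flipT2 : T2 n M →ₗ[SmoothFun n M] T2 n M := (TensorProduct.comm _ _ _).toLinearMap

/-- The projection `Ψ = (1 + σ)/2` onto symmetric two-tensors. -/
def symT2 : T2 n M →ₗ[SmoothFun n M] T2 n M :=
  algebraMap ℂ (SmoothFun n M) (1 / 2) • (LinearMap.id + flipT2 n M)

/-- The projection `P = Ψ ⊗ 1` on three-tensors. -/
def projP : T3 n M →ₗ[SmoothFun n M] T3 n M := (symT2 n M).rTensor (OneForm n M)

/-- The projection `Q = 1 ⊗ Ψ` on three-tensors. -/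
def projQ : T3 n M →ₗ[SmoothFun n M] T3 n M :=
  (TensorProduct.assoc _ _ _ _).symm.toLinearMap ∘ₗ (symT2 n M).lTensor (OneForm n M) ∘ₗ
    (TensorProduct.assoc _ _ _ _).toLinearMap

variable {n M}

/-- The involution on two-tensors, `(η ⊗ ξ)^† = ξ^† ⊗ η^†`. -/
def daggerT2 : T2 n M →ₛₗ[starRingEnd (SmoothFun n M)] T2 n M :=
  (flipT2 n M).comp (TensorProduct.map dagger dagger)

variable (n M)

/-- Universal one-forms `Ω¹_u(B)`, the kernel of the multiplication `B ⊗_ℂ B → B`; here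
`Σ a_i ⊗ b_i = Σ a_i δ(b_i)` on the kernel, with `δ(b) = 1 ⊗ b - b ⊗ 1`. -/
def universalForms : Submodule ℂ (SmoothFun n M ⊗[ℂ] SmoothFun n M) :=
  LinearMap.ker (LinearMap.mul' ℂ (SmoothFun n M))

variable {n M}

/-- The map `π : Ω¹_u(B) → Ω¹`, `Σ a_i δ(b_i) ↦ Σ a_i d(b_i)`. -/
def piU : universalForms n M →ₗ[ℂ] OneForm n M :=
  TensorProduct.lift (LinearMap.mk₂ ℂ (fun a b : SmoothFun n M => a • dFun b)
    (fun a a' b => add_smul a a' _) (fun c a b => smul_assoc c a _)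
    (fun a b b' => by rw [map_add, smul_add])
    (fun c a b => by rw [map_smul, smul_comm])) ∘ₗ (universalForms n M).subtype

/-- The map `π̂ ∘ δ : Ω¹_u(B) → T²`, `Σ a_i δ(b_i) ↦ Σ d(a_i) ⊗ d(b_i)`. -/
def piDelta : universalForms n M →ₗ[ℂ] T2 n M :=
  TensorProduct.lift (LinearMap.mk₂ ℂ (fun a b : SmoothFun n M => (dFun a ⊗ₜ dFun b : T2 n M))
    (fun a a' b => by rw [map_add, TensorProduct.add_tmul])
    (fun c a b => by rw [map_smul, TensorProduct.smul_tmul'])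
    (fun a b b' => by rw [map_add, TensorProduct.tmul_add])
    (fun c a b => by rw [map_smul, TensorProduct.tmul_smul])) ∘ₗ (universalForms n M).subtype

open Classical in
/-- The exterior derivative of a one-form as a two-tensor, `d = (1 - Ψ) ∘ π̂ ∘ δ ∘ π⁻¹`. -/
def exteriorD (η : OneForm n M) : T2 n M :=
  if h : ∃ u : universalForms n M, piU u = η then
    piDelta h.choose - symT2 n M (piDelta h.choose) else 0

/-- Evaluation of a one-form at a point. -/
def ev1 (x : M) : OneForm n M →ₛₗ[evalFun (n := n) x] CotC n x where
  toFun η := η x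
  map_add' _ _ := rfl
  map_smul' _ _ := rfl

/-- Evaluation of a two-tensor at a point. -/
def ev2 (x : M) : T2 n M →ₛₗ[evalFun (n := n) x] CotC n x ⊗[ℂ] CotC n x :=
  TensorProduct.map (ev1 x) (ev1 x)

/-- Evaluation of a three-tensor at a point. -/
def ev3 (x : M) : T3 n M →ₛₗ[evalFun (n := n) x] (CotC n x ⊗[ℂ] CotC n x) ⊗[ℂ] CotC n x :=
  TensorProduct.map (ev2 x) (ev1 x)

/-- The bilinear map sending `η ⊗ ξ` to `η(X) ξ(Y)`. -/
def evalPair {x : M} (X Y : TangentSpace (𝓡 n) x) : CotC n x ⊗[ℂ] CotC n x →ₗ[ℂ] ℂ :=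
  TensorProduct.lift (LinearMap.mk₂ ℂ (fun η ξ : CotC n x => η X * ξ Y)
    (fun _ _ _ => by simp [add_mul]) (fun _ _ _ => by simp [mul_assoc])
    (fun _ _ _ => by simp [mul_add]) (fun _ _ _ => by simp [mul_left_comm]))

end Tensor

/-! ## Connections -/

section Connections

variable {n : ℕ} {M : Type*} [TopologicalSpace M] [ChartedSpace (EuclideanSpace ℝ (Fin n)) M]
  [IsManifold (𝓡 n) ∞ M] [Bundle.RiemannianBundle (fun x : M => TangentSpace (𝓡 n) x)]
  [IsContMDiffRiemannianBundle (𝓡 n) ∞ (EuclideanSpace ℝ (Fin n))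
    (fun x : M => TangentSpace (𝓡 n) x)]

/-- The pairing `⟨η | t⟩` of a one-form with a two-tensor, `⟨η | ξ ⊗ ρ⟩ = ⟨η | ξ⟩ ρ`. -/
def pairR (η : OneForm n M) : T2 n M →ₗ[SmoothFun n M] OneForm n M :=
  TensorProduct.lift ((LinearMap.lsmul (SmoothFun n M) (OneForm n M)).comp (pairing η))

/-- The pairing `⟨t | η⟩` of a two-tensor with a one-form, `⟨ξ ⊗ ρ | η⟩ = ρ^† ⟨ξ | η⟩`. -/
def pairL (t : T2 n M) (η : OneForm n M) : OneForm n M := dagger (pairR η t)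

/-- The map `α : T³ → Hom_B(Ω¹, T²)`, `α(t ⊗ ξ)(η) = t ⟨ξ^† | η⟩`. -/
def alphaR : T3 n M →ₗ[SmoothFun n M] OneForm n M →ₗ[SmoothFun n M] T2 n M :=
  TensorProduct.lift (LinearMap.mk₂ (SmoothFun n M)
    (fun (t : T2 n M) (ξ : OneForm n M) =>
      (LinearMap.toSpanSingleton (SmoothFun n M) (T2 n M) t).comp (pairing (dagger ξ)))
    (fun t t' ξ => by ext; simp)
    (fun f t ξ => by ext; simp [smul_smul, mul_comm])
    (fun t ξ ξ' => by ext; simp [add_smul])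
    (fun f t ξ => by ext; simp [smul_smul]))

/-- The Grassmann connection `∇^v(η) = Σ_j ω_j ⊗ d⟨ω_j | η⟩` of a finite family `v = (ω_j)`. -/
def grassmann {κ : Type*} [Fintype κ] (v : κ → OneForm n M) : OneForm n M →ₗ[ℂ] T2 n M :=
  ∑ j, (TensorProduct.mk (SmoothFun n M) (OneForm n M) (OneForm n M) (v j)).restrictScalars ℂ ∘ₗ
    dFun ∘ₗ (pairing (v j)).restrictScalars ℂ

/-- The three-tensor `W = Σ_j d(ω_j) ⊗ ω_j^†` of a finite family `v = (ω_j)`. -/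
def tensorW {κ : Type*} [Fintype κ] (v : κ → OneForm n M) : T3 n M :=
  ∑ j, exteriorD (v j) ⊗ₜ dagger (v j)

/-- The three-tensor `A = (1 + 4PQ)(W)`. -/
def connForm {κ : Type*} [Fintype κ] (v : κ → OneForm n M) : T3 n M :=
  tensorW v + 4 • projP n M (projQ n M (tensorW v))

/-- A right connection that is Hermitian, torsion-free, and a `†`-bimodule connection for the flip
`σ`, that is, `σ ∘ ∇ = -† ∘ ∇ ∘ †`. -/
structure IsLeviCivita (D : OneForm n M →ₗ[ℂ] T2 n M) : Prop where
  leibniz : ∀ (η : OneForm n M) (b : SmoothFun n M), D (b • η) = b • D η + η ⊗ₜ dFun b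
  hermitian : ∀ η ξ : OneForm n M, dFun (pairing η ξ) = pairR η (D ξ) - pairL (D η) ξ
  torsionFree : ∀ η : OneForm n M, D η - symT2 n M (D η) + exteriorD η = 0
  bimodule : ∀ η : OneForm n M, flipT2 n M (D η) = -daggerT2 (D (dagger η))

end Connections

/-! ## Charts and local coordinate expressions -/

section Coordinates

variable {n : ℕ} {M : Type*} [TopologicalSpace M] [ChartedSpace (EuclideanSpace ℝ (Fin n)) M]

/-- The coordinate one-form `dx^μ` of a chart. -/
def coordForm (χ : OpenPartialHomeomorph M (EuclideanSpace ℝ (Fin n))) (μ : Fin n) (x : M) :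
    CotC n x :=
  mvfderiv (𝓡 n) (fun y => ((χ y μ : ℝ) : ℂ)) x

/-- The coordinate vector field `∂/∂x^μ` of a chart. -/
def coordVec (χ : OpenPartialHomeomorph M (EuclideanSpace ℝ (Fin n))) (μ : Fin n) (x : M) :
    TangentSpace (𝓡 n) x :=
  mfderiv (𝓡 n) (𝓡 n) χ.symm (χ x) (EuclideanSpace.single μ (1 : ℝ) : EuclideanSpace ℝ (Fin n))

/-- The partial derivative `f_{,ρ} = ∂f/∂x^ρ` in a chart. -/
def pd {F : Type*} [NormedAddCommGroup F] [NormedSpace ℝ F]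
    (χ : OpenPartialHomeomorph M (EuclideanSpace ℝ (Fin n))) (ρ : Fin n) (f : M → F) (x : M) : F :=
  fderiv ℝ (f ∘ χ.symm) (χ x) (EuclideanSpace.single ρ (1 : ℝ))

/-- The components `f_ν` of a form `f_ν dx^ν` in a chart. -/
def formComp (χ : OpenPartialHomeomorph M (EuclideanSpace ℝ (Fin n))) (η : ∀ x : M, CotC n x)
    (ν : Fin n) (x : M) : ℂ :=
  η x (coordVec χ ν x)

variable [IsManifold (𝓡 n) ∞ M]

theorem isSmoothFormAt_coordForm {χ : OpenPartialHomeomorph M (EuclideanSpace ℝ (Fin n))}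
    (hχ : χ ∈ IsManifold.maximalAtlas (𝓡 n) ∞ M) (μ : Fin n) {x₀ : M} (hx : x₀ ∈ χ.source) :
    IsSmoothFormAt (coordForm χ μ) x₀ := by
  apply isSmoothFormAt_mvfderiv
  have h := contMDiffAt_of_mem_maximalAtlas hχ hx
  have h2 : ContDiff ℝ ∞ (fun v : EuclideanSpace ℝ (Fin n) => ((v μ : ℝ) : ℂ)) :=
    Complex.ofRealCLM.contDiff.comp (EuclideanSpace.proj (𝕜 := ℝ) μ).contDiff
  exact h2.contMDiff.contMDiffAt.comp x₀ h

variable [Bundle.RiemannianBundle (fun x : M => TangentSpace (𝓡 n) x)]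

/-- The components `g_{μν}` of the metric in a chart. -/
def gLow (χ : OpenPartialHomeomorph M (EuclideanSpace ℝ (Fin n))) (μ ν : Fin n) (x : M) : ℝ :=
  inner ℝ (coordVec χ μ x) (coordVec χ ν x)

/-- The components `g^{μν}` of the inverse metric in a chart. -/
def gUp (χ : OpenPartialHomeomorph M (EuclideanSpace ℝ (Fin n))) (μ ν : Fin n) (x : M) : ℝ :=
  (Matrix.of fun i j => gLow χ i j x)⁻¹ μ ν

/-- The Christoffel symbols `Γ^ν_{μρ}` of the metric in a chart. -/
def christoffel (χ : OpenPartialHomeomorph M (EuclideanSpace ℝ (Fin n))) (ν μ ρ : Fin n)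
    (x : M) : ℝ :=
  (1 / 2) * ∑ σ, gUp χ ν σ x * (pd χ μ (gLow χ σ ρ) x + pd χ ρ (gLow χ σ μ) x -
    pd χ σ (gLow χ μ ρ) x)

variable (n M) in
/-- A finite partition of unity `φ_α` with smooth square roots, subordinate to coordinate charts,
and on each chart domain an orthonormal coframe `e^j = B^j_μ dx^μ`. -/
structure CoframeData (ι : Type*) where
  chart : ι → OpenPartialHomeomorph M (EuclideanSpace ℝ (Fin n))
  chart_mem : ∀ α, chart α ∈ IsManifold.maximalAtlas (𝓡 n) ∞ M
  φ : SmoothPartitionOfUnity ι (𝓡 n) M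
  subordinate : φ.IsSubordinate fun α => (chart α).source
  sqrt_smooth : ∀ α, ContMDiff (𝓡 n) 𝓘(ℝ, ℝ) ∞ fun x => √(φ α x)
  B : ι → Fin n → Fin n → M → ℝ
  B_smooth : ∀ α j μ, ContMDiffOn (𝓡 n) 𝓘(ℝ, ℝ) ∞ (B α j μ) (chart α).source
  orthonormal : ∀ α, ∀ x ∈ (chart α).source, ∀ j k,
    cotInner (∑ μ, (B α j μ x : ℂ) • coordForm (chart α) μ x)
      (∑ μ, (B α k μ x : ℂ) • coordForm (chart α) μ x) = if j = k then 1 else 0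

/-- The global frame `ω_{jα} = √φ_α B^j_μ dx^μ = √φ_α e^j`. -/
def CoframeData.frame {ι : Type*} (D : CoframeData n M ι) (p : ι × Fin n) : OneForm n M where
  val x := ((√(D.φ p.1 x) : ℝ) : ℂ) • ∑ μ, (D.B p.1 p.2 μ x : ℂ) • coordForm (D.chart p.1) μ x
  smooth x₀ := by
    by_cases hx : x₀ ∈ (D.chart p.1).source
    · refine IsSmoothFormAt.smul
        (Complex.ofRealCLM.contDiff.contMDiff.contMDiffAt.comp x₀ (D.sqrt_smooth p.1 x₀)) ?_
      refine IsSmoothFormAt.sum fun μ _ => IsSmoothFormAt.smul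
        (Complex.ofRealCLM.contDiff.contMDiff.contMDiffAt.comp x₀
          ((D.B_smooth p.1 p.2 μ).contMDiffAt ((D.chart p.1).open_source.mem_nhds hx)))
        (isSmoothFormAt_coordForm (D.chart_mem p.1) μ hx)
    · have h0 : x₀ ∉ tsupport (D.φ p.1) := fun h => hx (D.subordinate p.1 h)
      refine (isSmoothFormAt_zero x₀).congr_eventually ?_
      filter_upwards [(isClosed_tsupport _).isOpen_compl.mem_nhds h0] with x hx'
      have : D.φ p.1 x = 0 := image_eq_zero_of_notMem_tsupport hx'
      simp only [this, Real.sqrt_zero, Complex.ofReal_zero]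
      exact zero_smul ℂ (_ : CotC n x)

variable (n M) in
/-- A covariant derivative on the tangent bundle is the classical Levi-Civita connection if it is
torsion-free and compatible with the metric. -/
def IsClassicalLeviCivita [IsContMDiffRiemannianBundle (𝓡 n) ∞ (EuclideanSpace ℝ (Fin n))
      (fun x : M => TangentSpace (𝓡 n) x)]
    (cov : CovariantDerivative (𝓡 n) (EuclideanSpace ℝ (Fin n))
      (fun x : M => TangentSpace (𝓡 n) x)) : Prop :=
  have : IsContMDiffRiemannianBundle (𝓡 n) 1 (EuclideanSpace ℝ (Fin n))
      (fun x : M => TangentSpace (𝓡 n) x) := .of_le (n := ∞) (by simp)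
  cov.torsion = 0 ∧ cov.IsMetricCompatible

end Coordinates

end RiemannianCalculus
end

open RiemannianCalculus

/-!
Every tensor is studied through its values on tangent vectors, in an arbitrary chart, where
one-forms become functions `η_μ` and everything reduces to calculus with partial derivatives.

The forms `θ_p = ω_{jα}` are real and satisfy the Parseval identity `∑ p, θ_p(v) θ_p(w) = ⟨v, w⟩`
(`CoframeData.isParsevalFrame`). This gives the reconstruction formula `η = ∑ p, θ_p ⟨θ_p | η⟩`,
and by reconstructing the factors of a tensor one after another it shows that two- and
three-tensors over the smooth functions are determined by their values at points
(`IsParsevalFrame.tensor2_eq_zero`, `IsParsevalFrame.tensor3_eq_zero`).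

The exterior derivative is defined through a preimage `∑ a ⊗ b` of the form `∑ a db`. Preimages
exist (`CoframeData.exists_piU_eq`): with `s = √φ_α`, the form `s² f dx^μ` is
`(s f) d(s x^μ) - (s f x^μ) ds`, in which every function is defined on all of `M`. The result does
not depend on the preimage, because second partial derivatives commute (`val2_exteriorD`).

Since `W` is antisymmetric in its first two arguments,
`A(X, Y, Z) = W(X, Y, Z) + W(X, Z, Y) + W(Y, Z, X)` (`val3_connForm`). In a chart this is a sum of
products `∂θ_p · θ_p`. By the product rule and the Parseval identity it becomes, up to sign, the
combination of derivatives of the metric that occurs in the Christoffel symbols minus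
`∑ p, ∂_μ θ_{pρ} θ_{pσ}` (`val3_connForm_coordVec`). This last sum is what turns
`∑ p, θ_p ⊗ d⟨θ_p | η⟩` into the plain derivatives `∂_ρ η_ν`, so that `∇^v η - α(A) η` has the
components `∂_ρ η_ν - Γ^τ_{ρν} η_τ` (`IsParsevalFrame.val2_connection`). From these components the
Leibniz rule, the vanishing of the torsion and the compatibility with `†` can be read off. The
connection is Hermitian because `A` is real and antisymmetric in its outer arguments, while the
Grassmann connection `∇^v` is Hermitian for every Parseval frame.

The difference of two Levi-Civita connections is linear over the smooth functions. Its components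
in the frame are symmetric in one pair of indices and antisymmetric in an overlapping pair, hence
zero (`IsParsevalFrame.leviCivita_unique`).

For the explicit formula, `A` is the sum over `α` of the forms belonging to the parts `√φ_α e^j`
of the frame. For fixed `α` the sum `∑ j, θ_{jα} θ_{jα}` is `φ_α g`, and the product rule gives
the stated coefficients, multiplied by `φ_α`, and a remainder linear in `dφ_α`. The remainders
cancel because `∑ α, φ_α = 1` (`CoframeData.ev3_connForm`).

A torsion-free metric covariant derivative on the tangent bundle satisfies the Koszul formula on
coordinate fields, which commute, and therefore has the same Christoffel symbols. As
`X ↦ Y(η(X)) - η(∇_Y X)` is tensorial, the comparison extends to all differentiable vector fields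
(`IsParsevalFrame.evalPair_connection`).
-/

noncomputable section

set_option linter.unusedSectionVars false

namespace RiemannianCalculus

/-! ### Differential calculus in a chart -/

section ChartCalculus

variable {n : ℕ} {M : Type*} [TopologicalSpace M] [ChartedSpace (EuclideanSpace ℝ (Fin n)) M]
variable {χ : OpenPartialHomeomorph M (EuclideanSpace ℝ (Fin n))} {x : M}
variable {F : Type*} [NormedAddCommGroup F] [NormedSpace ℝ F]

/-- Differentiability at `x` of a function read in the chart `χ`. -/
def DiffInChart (χ : OpenPartialHomeomorph M (EuclideanSpace ℝ (Fin n))) (f : M → F) (x : M) :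
    Prop :=
  DifferentiableAt ℝ (f ∘ χ.symm) (χ x)

theorem eventually_comp_symm (hx : x ∈ χ.source) {p : M → Prop} (h : ∀ᶠ y in nhds x, p y) :
    ∀ᶠ v in nhds (χ x), p (χ.symm v) := by
  have := χ.continuousAt_symm (χ.map_source hx)
  rw [ContinuousAt, χ.left_inv hx] at this
  exact this.eventually h

theorem pd_congr (hx : x ∈ χ.source) {f g : M → F} (h : f =ᶠ[nhds x] g) (ρ : Fin n) :
    pd χ ρ f x = pd χ ρ g x := by
  have : f ∘ χ.symm =ᶠ[nhds (χ x)] g ∘ χ.symm := eventually_comp_symm hx h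
  simp only [pd, this.fderiv_eq]

theorem pd_const (c : F) (ρ : Fin n) : pd χ ρ (fun _ : M => c) x = 0 := by
  have : (fun _ : M => c) ∘ χ.symm = fun _ => c := rfl
  simp [pd, this]

theorem pd_add {f g : M → F} (hf : DiffInChart χ f x) (hg : DiffInChart χ g x) (ρ : Fin n) :
    pd χ ρ (fun y => f y + g y) x = pd χ ρ f x + pd χ ρ g x := by
  have : (fun y => f y + g y) ∘ χ.symm = f ∘ χ.symm + g ∘ χ.symm := rfl
  simp [pd, this, fderiv_add hf hg]

theorem pd_sum {κ : Type*} {s : Finset κ} {f : κ → M → F}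
    (hf : ∀ i ∈ s, DiffInChart χ (f i) x) (ρ : Fin n) :
    pd χ ρ (fun y => ∑ i ∈ s, f i y) x = ∑ i ∈ s, pd χ ρ (f i) x := by
  have : (fun y => ∑ i ∈ s, f i y) ∘ χ.symm = fun v => ∑ i ∈ s, (f i ∘ χ.symm) v := rfl
  simp only [pd, this]
  rw [fderiv_fun_sum hf, sum_apply]

theorem pd_mul {A : Type*} [NormedCommRing A] [NormedAlgebra ℝ A] {f g : M → A}
    (hf : DiffInChart χ f x) (hg : DiffInChart χ g x) (hx : x ∈ χ.source) (ρ : Fin n) :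
    pd χ ρ (fun y => f y * g y) x = pd χ ρ f x * g x + f x * pd χ ρ g x := by
  have : (fun y => f y * g y) ∘ χ.symm = (f ∘ χ.symm) * (g ∘ χ.symm) := rfl
  simp only [pd, this, fderiv_mul hf hg]
  simp [χ.left_inv hx]
  ring

theorem pd_clm_comp {G : Type*} [NormedAddCommGroup G] [NormedSpace ℝ G] (L : F →L[ℝ] G)
    {f : M → F} (hf : DiffInChart χ f x) (ρ : Fin n) :
    pd χ ρ (fun y => L (f y)) x = L (pd χ ρ f x) := by
  have : (fun y => L (f y)) ∘ χ.symm = L ∘ (f ∘ χ.symm) := rfl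
  simp only [pd, this]
  rw [fderiv_comp _ L.differentiableAt hf, L.fderiv]
  rfl

theorem DiffInChart.mul {A : Type*} [NormedCommRing A] [NormedAlgebra ℝ A] {f g : M → A}
    (hf : DiffInChart χ f x) (hg : DiffInChart χ g x) :
    DiffInChart χ (fun y => f y * g y) x :=
  DifferentiableAt.mul hf hg

variable [IsManifold (𝓡 n) ∞ M]

theorem contMDiffAt_chart_symm (hχ : χ ∈ IsManifold.maximalAtlas (𝓡 n) ∞ M)
    (hx : x ∈ χ.source) : ContMDiffAt (𝓡 n) (𝓡 n) ∞ χ.symm (χ x) :=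
  (contMDiffOn_symm_of_mem_maximalAtlas hχ).contMDiffAt
    (χ.open_target.mem_nhds (χ.map_source hx))

theorem mdifferentiable_of_mem_maximalAtlas (hχ : χ ∈ IsManifold.maximalAtlas (𝓡 n) ∞ M) :
    χ.MDifferentiable (𝓡 n) (𝓡 n) :=
  ⟨(contMDiffOn_of_mem_maximalAtlas hχ).mdifferentiableOn (by simp),
    (contMDiffOn_symm_of_mem_maximalAtlas hχ).mdifferentiableOn (by simp)⟩

theorem contDiffAt_comp_symm (hχ : χ ∈ IsManifold.maximalAtlas (𝓡 n) ∞ M) (hx : x ∈ χ.source)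
    {f : M → F} (hf : ContMDiffAt (𝓡 n) 𝓘(ℝ, F) ∞ f x) : ContDiffAt ℝ ∞ (f ∘ χ.symm) (χ x) := by
  have h := contMDiffAt_chart_symm hχ hx
  rw [← χ.left_inv hx] at hf
  exact (hf.comp (χ x) h).contDiffAt

theorem diffInChart_of_mdifferentiableAt (hχ : χ ∈ IsManifold.maximalAtlas (𝓡 n) ∞ M)
    (hx : x ∈ χ.source) {f : M → F} (hf : MDifferentiableAt (𝓡 n) 𝓘(ℝ, F) f x) :
    DiffInChart χ f x := by
  have h := (contMDiffAt_chart_symm hχ hx).mdifferentiableAt (by simp)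
  rw [← χ.left_inv hx] at hf
  exact (hf.comp (χ x) h).differentiableAt

theorem diffInChart_of_contMDiffAt (hχ : χ ∈ IsManifold.maximalAtlas (𝓡 n) ∞ M)
    (hx : x ∈ χ.source) {f : M → F} (hf : ContMDiffAt (𝓡 n) 𝓘(ℝ, F) ∞ f x) :
    DiffInChart χ f x :=
  diffInChart_of_mdifferentiableAt hχ hx (hf.mdifferentiableAt (by simp))

/-- The differential of a function applied to a coordinate vector is a partial derivative. -/
theorem mvfderiv_coordVec (hχ : χ ∈ IsManifold.maximalAtlas (𝓡 n) ∞ M)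
    (hx : x ∈ χ.source) {f : M → F} (hf : MDifferentiableAt (𝓡 n) 𝓘(ℝ, F) f x) (ρ : Fin n) :
    mvfderiv (𝓡 n) f x (coordVec χ ρ x) = pd χ ρ f x := by
  have h := (contMDiffAt_chart_symm hχ hx).mdifferentiableAt (by simp)
  have h2 := mfderiv_comp_of_eq hf h (χ.left_inv hx)
  rw [mfderiv_eq_fderiv, χ.left_inv hx] at h2
  exact (congrArg (fun T => T (EuclideanSpace.single ρ (1 : ℝ))) h2).symm

/-- The basis of `T_x M` given by the coordinate vector fields of a chart. -/
def coordBasis (hχ : χ ∈ IsManifold.maximalAtlas (𝓡 n) ∞ M) (hx : x ∈ χ.source) :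
    Module.Basis (Fin n) ℝ (TangentSpace (𝓡 n) x) :=
  (EuclideanSpace.basisFun (Fin n) ℝ).toBasis.map
    ((mdifferentiable_of_mem_maximalAtlas hχ).mfderiv hx).symm.toLinearEquiv

@[simp] theorem coordBasis_apply (hχ : χ ∈ IsManifold.maximalAtlas (𝓡 n) ∞ M)
    (hx : x ∈ χ.source) (μ : Fin n) : coordBasis hχ hx μ = coordVec χ μ x := by
  refine (Module.Basis.map_apply _ _ _).trans ?_
  rw [OrthonormalBasis.coe_toBasis, EuclideanSpace.basisFun_apply]
  rfl

theorem contMDiffAt_coordinate (hχ : χ ∈ IsManifold.maximalAtlas (𝓡 n) ∞ M)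
    (hx : x ∈ χ.source) (μ : Fin n) :
    ContMDiffAt (𝓡 n) 𝓘(ℝ, ℂ) ∞ (fun y => ((χ y μ : ℝ) : ℂ)) x := by
  have h := contMDiffAt_of_mem_maximalAtlas hχ hx
  have h2 : ContDiff ℝ ∞ (fun v : EuclideanSpace ℝ (Fin n) => ((v μ : ℝ) : ℂ)) :=
    Complex.ofRealCLM.contDiff.comp (EuclideanSpace.proj (𝕜 := ℝ) μ).contDiff
  exact h2.contMDiff.contMDiffAt.comp x h

theorem coordForm_coordVec (hχ : χ ∈ IsManifold.maximalAtlas (𝓡 n) ∞ M)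
    (hx : x ∈ χ.source) (μ ν : Fin n) :
    coordForm χ μ x (coordVec χ ν x) = if μ = ν then 1 else 0 := by
  rw [coordForm, mvfderiv_coordVec hχ hx
    ((contMDiffAt_coordinate hχ hx μ).mdifferentiableAt (by simp))]
  have h : (fun y => ((χ y μ : ℝ) : ℂ)) ∘ χ.symm =ᶠ[nhds (χ x)]
      (Complex.ofRealCLM.comp (EuclideanSpace.proj (𝕜 := ℝ) μ) :
        EuclideanSpace ℝ (Fin n) →L[ℝ] ℂ) := by
    filter_upwards [χ.open_target.mem_nhds (χ.map_source hx)] with v hv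
    simp [χ.right_inv hv]
  rw [pd, h.fderiv_eq, ContinuousLinearMap.fderiv]
  by_cases h : μ = ν <;> simp [h]

theorem cot_ext_coordVec (hχ : χ ∈ IsManifold.maximalAtlas (𝓡 n) ∞ M) (hx : x ∈ χ.source)
    {η ξ : CotC n x} (h : ∀ μ, η (coordVec χ μ x) = ξ (coordVec χ μ x)) : η = ξ := by
  have : (η : TangentSpace (𝓡 n) x →ₗ[ℝ] ℂ) = ξ :=
    (coordBasis hχ hx).ext fun μ => by simpa using h μ
  exact ContinuousLinearMap.coe_injective this

theorem sum_coordForm (hχ : χ ∈ IsManifold.maximalAtlas (𝓡 n) ∞ M) (hx : x ∈ χ.source)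
    (η : CotC n x) : ∑ ν, η (coordVec χ ν x) • coordForm χ ν x = η := by
  refine cot_ext_coordVec hχ hx fun μ => ?_
  simp [coordForm_coordVec hχ hx]

/-- The constant vector field `∂/∂v^μ` on Euclidean space. -/
def constField (μ : Fin n) (v : EuclideanSpace ℝ (Fin n)) :
    TangentSpace 𝓘(ℝ, EuclideanSpace ℝ (Fin n)) v :=
  (EuclideanSpace.single μ (1 : ℝ) : EuclideanSpace ℝ (Fin n))

theorem contMDiffAt_constField (μ : Fin n) (v : EuclideanSpace ℝ (Fin n)) :
    ContMDiffAt 𝓘(ℝ, EuclideanSpace ℝ (Fin n))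
      (𝓘(ℝ, EuclideanSpace ℝ (Fin n)).prod 𝓘(ℝ, EuclideanSpace ℝ (Fin n))) ∞
      (fun w : EuclideanSpace ℝ (Fin n) => (⟨w, constField μ w⟩ :
        TangentBundle 𝓘(ℝ, EuclideanSpace ℝ (Fin n)) (EuclideanSpace ℝ (Fin n)))) v :=
  contMDiffAt_vectorSpace_iff_contDiffAt.2
    (contDiffAt_const (c := (EuclideanSpace.single μ (1 : ℝ) : EuclideanSpace ℝ (Fin n))))

theorem coordVec_eq_mpullback (hχ : χ ∈ IsManifold.maximalAtlas (𝓡 n) ∞ M) (hx : x ∈ χ.source)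
    (μ : Fin n) : coordVec χ μ x =
      VectorField.mpullback (𝓡 n) 𝓘(ℝ, EuclideanSpace ℝ (Fin n)) χ (constField μ) x := by
  rw [VectorField.mpullback_apply]
  have h : mfderiv (𝓡 n) 𝓘(ℝ, EuclideanSpace ℝ (Fin n)) χ x =
      ((mdifferentiable_of_mem_maximalAtlas hχ).mfderiv hx).toContinuousLinearMap := rfl
  rw [h, ContinuousLinearMap.inverse_equiv]
  rfl

theorem isInvertible_mfderiv_chart (hχ : χ ∈ IsManifold.maximalAtlas (𝓡 n) ∞ M)
    (hx : x ∈ χ.source) :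
    (mfderiv (𝓡 n) 𝓘(ℝ, EuclideanSpace ℝ (Fin n)) χ x).IsInvertible :=
  ⟨(mdifferentiable_of_mem_maximalAtlas hχ).mfderiv hx, rfl⟩

theorem contMDiffAt_coordVec (hχ : χ ∈ IsManifold.maximalAtlas (𝓡 n) ∞ M) (hx : x ∈ χ.source)
    (μ : Fin n) : ContMDiffAt (𝓡 n) ((𝓡 n).prod 𝓘(ℝ, EuclideanSpace ℝ (Fin n))) ∞
      (fun y => Bundle.TotalSpace.mk' (EuclideanSpace ℝ (Fin n)) y (coordVec χ μ y)) x := by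
  have h := ContMDiffAt.mpullback_vectorField_preimage (n := ∞) (m := ∞)
    (contMDiffAt_constField μ (χ x))
    (contMDiffAt_of_mem_maximalAtlas hχ hx) (isInvertible_mfderiv_chart hχ hx) (by simp)
  refine h.congr_of_eventuallyEq ?_
  filter_upwards [χ.open_source.mem_nhds hx] with y hy
  rw [coordVec_eq_mpullback hχ hy]

theorem two_le_infty : (2 : WithTop ℕ∞) ≤ ∞ := by
  exact WithTop.coe_le_coe.2 (le_top : (2 : ℕ∞) ≤ ⊤)

/-- Coordinate vector fields commute. -/
theorem mlieBracket_coordVec (hχ : χ ∈ IsManifold.maximalAtlas (𝓡 n) ∞ M) (hx : x ∈ χ.source)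
    (μ ν : Fin n) :
    VectorField.mlieBracket (𝓡 n) (coordVec χ μ) (coordVec χ ν) x = 0 := by
  have hle : minSmoothness ℝ 2 ≤ ∞ := by simpa using two_le_infty
  have : IsManifold (𝓡 n) (minSmoothness ℝ 2) M := .of_le (n := ∞) hle
  have h := VectorField.mpullback_mlieBracket (I := 𝓡 n)
    (I' := 𝓘(ℝ, EuclideanSpace ℝ (Fin n))) (n := ∞)
    ((contMDiffAt_constField μ (χ x)).mdifferentiableAt (by simp))
    ((contMDiffAt_constField ν (χ x)).mdifferentiableAt (by simp))
    (contMDiffAt_of_mem_maximalAtlas hχ hx) hle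
  have he : ∀ μ, coordVec χ μ =ᶠ[nhds x] VectorField.mpullback (𝓡 n)
      𝓘(ℝ, EuclideanSpace ℝ (Fin n)) χ (constField μ) := fun μ => by
    filter_upwards [χ.open_source.mem_nhds hx] with y hy
    rw [coordVec_eq_mpullback hχ hy]
  rw [(he μ).mlieBracket_vectorField_eq (he ν)]
  refine h.symm.trans ?_
  have h0 : VectorField.mlieBracket 𝓘(ℝ, EuclideanSpace ℝ (Fin n))
      (constField μ) (constField ν) (χ x) = 0 := by
    have h1 : VectorField.lieBracketWithin ℝ
        (fun _ => (EuclideanSpace.single μ (1 : ℝ) : EuclideanSpace ℝ (Fin n)))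
        (fun _ => (EuclideanSpace.single ν (1 : ℝ) : EuclideanSpace ℝ (Fin n)))
        Set.univ (χ x) = 0 := by
      simp [VectorField.lieBracketWithin]
    rw [← VectorField.mlieBracketWithin_univ, VectorField.mlieBracketWithin_eq_lieBracketWithin]
    exact h1
  rw [VectorField.mpullback_apply, h0, map_zero]

/-- The components of a smooth form in a chart are smooth. -/
theorem contMDiffAt_formComp (hχ : χ ∈ IsManifold.maximalAtlas (𝓡 n) ∞ M) (hx : x ∈ χ.source)
    {η : ∀ y : M, CotC n y} (hη : IsSmoothFormAt η x) (μ : Fin n) :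
    ContMDiffAt (𝓡 n) 𝓘(ℝ, ℂ) ∞ (formComp χ η μ) x := by
  have h := ContMDiffAt.clm_bundle_apply (F₁ := EuclideanSpace ℝ (Fin n)) (F₂ := ℂ)
    (E₁ := fun y : M => TangentSpace (𝓡 n) y) (E₂ := Bundle.Trivial M ℂ) (b := fun y : M => y)
    hη (contMDiffAt_coordVec hχ hx μ)
  rw [Bundle.contMDiffAt_section] at h
  simpa using! h

theorem diffInChart_formComp (hχ : χ ∈ IsManifold.maximalAtlas (𝓡 n) ∞ M) (hx : x ∈ χ.source)
    (η : OneForm n M) (μ : Fin n) : DiffInChart χ (formComp χ η μ) x :=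
  diffInChart_of_contMDiffAt hχ hx (contMDiffAt_formComp hχ hx (η.smooth x) μ)

theorem formComp_dFun (hχ : χ ∈ IsManifold.maximalAtlas (𝓡 n) ∞ M) (hx : x ∈ χ.source)
    (f : SmoothFun n M) (μ : Fin n) : formComp χ (dFun f) μ x = pd χ μ f x :=
  mvfderiv_coordVec hχ hx ((f.2 x).mdifferentiableAt (by simp)) μ

/-- Mixed partial derivatives of a smooth function commute. -/
theorem pd_formComp_dFun_comm (hχ : χ ∈ IsManifold.maximalAtlas (𝓡 n) ∞ M) (hx : x ∈ χ.source)
    (f : SmoothFun n M) (μ ν : Fin n) :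
    pd χ ν (formComp χ (dFun f) μ) x = pd χ μ (formComp χ (dFun f) ν) x := by
  have hf := contDiffAt_comp_symm hχ hx (f.2 x)
  have key : ∀ μ ν, pd χ ν (formComp χ (dFun f) μ) x =
      fderiv ℝ (fderiv ℝ (f.1 ∘ χ.symm)) (χ x) (EuclideanSpace.single ν 1)
        (EuclideanSpace.single μ 1) := by
    intro μ ν
    have h : formComp χ (dFun f) μ ∘ χ.symm =ᶠ[nhds (χ x)]
        fun v => fderiv ℝ (f.1 ∘ χ.symm) v (EuclideanSpace.single μ 1) := by
      filter_upwards [χ.open_target.mem_nhds (χ.map_source hx)] with v hv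
      simp only [Function.comp]
      rw [formComp_dFun hχ (χ.map_target hv), pd, χ.right_inv hv]
    have hd : DifferentiableAt ℝ (fderiv ℝ (f.1 ∘ χ.symm)) (χ x) :=
      (hf.fderiv_right (m := 1) (by norm_cast)).differentiableAt (by simp)
    rw [pd, h.fderiv_eq, fderiv_clm_apply hd (by simp)]
    simp
  rw [key, key]
  have hs := hf.isSymmSndFDerivAt (by simpa using two_le_infty)
  exact hs _ _

end ChartCalculus

/-! ### Tensors evaluated on tangent vectors -/

section Evaluation

variable {n : ℕ} {M : Type*} [TopologicalSpace M] [ChartedSpace (EuclideanSpace ℝ (Fin n)) M]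
  [IsManifold (𝓡 n) ∞ M]
variable {x : M}

/-- The bilinear evaluation sending `t ⊗ ξ` to `t(X, Y) ξ(Z)`. -/
def evalTriple (X Y Z : TangentSpace (𝓡 n) x) :
    (CotC n x ⊗[ℂ] CotC n x) ⊗[ℂ] CotC n x →ₗ[ℂ] ℂ :=
  TensorProduct.lift (LinearMap.mk₂ ℂ (fun t ξ => evalPair X Y t * ξ Z)
    (fun _ _ _ => by simp [add_mul]) (fun _ _ _ => by simp [mul_assoc])
    (fun _ _ _ => by simp [mul_add]) (fun _ _ _ => by simp [mul_left_comm]))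

@[simp] theorem evalPair_tmul (X Y : TangentSpace (𝓡 n) x) (η ξ : CotC n x) :
    evalPair X Y (η ⊗ₜ ξ) = η X * ξ Y := rfl

@[simp] theorem evalTriple_tmul (X Y Z : TangentSpace (𝓡 n) x) (t : CotC n x ⊗[ℂ] CotC n x)
    (ξ : CotC n x) : evalTriple X Y Z (t ⊗ₜ ξ) = evalPair X Y t * ξ Z := rfl

/-- The value `t(X, Y)` of a two-tensor on tangent vectors. -/
def val2 (t : T2 n M) (X Y : TangentSpace (𝓡 n) x) : ℂ := evalPair X Y (ev2 x t)

/-- The value `t(X, Y, Z)` of a three-tensor on tangent vectors. -/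
def val3 (t : T3 n M) (X Y Z : TangentSpace (𝓡 n) x) : ℂ := evalTriple X Y Z (ev3 x t)

variable (X Y Z : TangentSpace (𝓡 n) x)

theorem smoothFun_algebraMap_apply (c : ℂ) (y : M) :
    (algebraMap ℂ (SmoothFun n M) c) y = c := rfl

@[simp] theorem evalFun_apply (f : SmoothFun n M) : evalFun x f = f x := rfl

@[simp] theorem val2_tmul (η ξ : OneForm n M) : val2 (η ⊗ₜ ξ) X Y = η x X * ξ x Y := rfl
@[simp] theorem val2_zero : val2 (0 : T2 n M) X Y = 0 := by simp [val2]
@[simp] theorem val2_add (s t : T2 n M) : val2 (s + t) X Y = val2 s X Y + val2 t X Y := by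
  simp [val2]
@[simp] theorem val2_neg (t : T2 n M) : val2 (-t) X Y = -val2 t X Y := by simp [val2]
@[simp] theorem val2_sub (s t : T2 n M) : val2 (s - t) X Y = val2 s X Y - val2 t X Y := by
  simp [val2]
@[simp] theorem val2_smul (f : SmoothFun n M) (t : T2 n M) :
    val2 (f • t) X Y = f x * val2 t X Y := by
  simp [val2, map_smulₛₗ]
@[simp] theorem val2_sum {κ : Type*} (s : Finset κ) (t : κ → T2 n M) :
    val2 (∑ i ∈ s, t i) X Y = ∑ i ∈ s, val2 (t i) X Y := by simp [val2]

@[simp] theorem val3_tmul (t : T2 n M) (ξ : OneForm n M) :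
    val3 (t ⊗ₜ ξ) X Y Z = val2 t X Y * ξ x Z := rfl
@[simp] theorem val3_zero : val3 (0 : T3 n M) X Y Z = 0 := by simp [val3]
@[simp] theorem val3_add (s t : T3 n M) :
    val3 (s + t) X Y Z = val3 s X Y Z + val3 t X Y Z := by simp [val3]
@[simp] theorem val3_nsmul (k : ℕ) (t : T3 n M) :
    val3 (k • t) X Y Z = k * val3 t X Y Z := by simp [val3]
@[simp] theorem val3_sum {κ : Type*} (s : Finset κ) (t : κ → T3 n M) :
    val3 (∑ i ∈ s, t i) X Y Z = ∑ i ∈ s, val3 (t i) X Y Z := by simp [val3]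

@[simp] theorem val2_flipT2 (t : T2 n M) : val2 (flipT2 n M t) X Y = val2 t Y X := by
  induction t using TensorProduct.induction_on with
  | zero => simp
  | add s t hs ht => simp [hs, ht]
  | tmul η ξ =>
    change ξ x X * η x Y = η x Y * ξ x X
    ring

@[simp] theorem val2_symT2 (t : T2 n M) :
    val2 (symT2 n M t) X Y = (1 / 2) * (val2 t X Y + val2 t Y X) := by
  simp only [symT2, LinearMap.smul_apply, LinearMap.add_apply, LinearMap.id_apply, val2_smul,
    val2_add, val2_flipT2, smoothFun_algebraMap_apply]

theorem dagger_apply (η : OneForm n M) : dagger η x X = -conj (η x X) := rfl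

@[simp] theorem val2_daggerT2 (t : T2 n M) : val2 (daggerT2 t) X Y = conj (val2 t Y X) := by
  induction t using TensorProduct.induction_on with
  | zero => simp
  | add s t hs ht => simp [hs, ht]
  | tmul η ξ =>
    change dagger ξ x X * dagger η x Y = _
    simp [dagger_apply, mul_comm]

@[simp] theorem val3_projP (t : T3 n M) :
    val3 (projP n M t) X Y Z = (1 / 2) * (val3 t X Y Z + val3 t Y X Z) := by
  induction t using TensorProduct.induction_on with
  | zero => simp
  | add s t hs ht => simp only [map_add, val3_add, hs, ht]; ring
  | tmul s ξ =>
    simp only [projP, LinearMap.rTensor_tmul, val3_tmul, val2_symT2]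
    ring

/-- Evaluation of `ρ ⊗ t`, reassociated, in terms of the values of `ρ` and `t`. -/
theorem val3_assoc_symm (ρ : OneForm n M) (t : T2 n M) :
    val3 ((TensorProduct.assoc (SmoothFun n M) _ _ _).symm (ρ ⊗ₜ t) : T3 n M) X Y Z =
      ρ x X * val2 t Y Z := by
  induction t using TensorProduct.induction_on with
  | zero => simp
  | add s t hs ht => simp only [TensorProduct.tmul_add, map_add, val3_add, val2_add, hs, ht]; ring
  | tmul η ξ =>
    rw [TensorProduct.assoc_symm_tmul, val3_tmul, val2_tmul, val2_tmul, mul_assoc]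

@[simp] theorem val3_projQ (t : T3 n M) :
    val3 (projQ n M t) X Y Z = (1 / 2) * (val3 t X Y Z + val3 t X Z Y) := by
  induction t using TensorProduct.induction_on with
  | zero => simp
  | add s t hs ht => simp only [map_add, val3_add, hs, ht]; ring
  | tmul s ξ =>
    induction s using TensorProduct.induction_on with
    | zero => simp
    | add s t hs ht =>
      simp only [TensorProduct.add_tmul, map_add, val3_add, hs, ht]; ring
    | tmul η ρ =>
      simp only [projQ, LinearMap.comp_apply, LinearEquiv.coe_coe, TensorProduct.assoc_tmul,
        LinearMap.lTensor_tmul, val3_assoc_symm, val2_symT2, val3_tmul, val2_tmul]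
      ring

variable {χ : OpenPartialHomeomorph M (EuclideanSpace ℝ (Fin n))}

theorem tensor2_eq_sum (hχ : χ ∈ IsManifold.maximalAtlas (𝓡 n) ∞ M) (hx : x ∈ χ.source)
    (t : CotC n x ⊗[ℂ] CotC n x) :
    t = ∑ ν, ∑ ρ, evalPair (coordVec χ ν x) (coordVec χ ρ x) t •
      (coordForm χ ν x ⊗ₜ[ℂ] coordForm χ ρ x) := by
  induction t using TensorProduct.induction_on with
  | zero => simp
  | add s t hs ht =>
    simp only [map_add, add_smul, Finset.sum_add_distrib]
    rw [← hs, ← ht]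
  | tmul η ξ =>
    conv_lhs => rw [← sum_coordForm hχ hx η, ← sum_coordForm hχ hx ξ]
    simp only [TensorProduct.sum_tmul, TensorProduct.tmul_sum, evalPair_tmul,
      TensorProduct.smul_tmul_smul]
    exact Finset.sum_comm

theorem tensor3_eq_sum (hχ : χ ∈ IsManifold.maximalAtlas (𝓡 n) ∞ M) (hx : x ∈ χ.source)
    (t : (CotC n x ⊗[ℂ] CotC n x) ⊗[ℂ] CotC n x) :
    t = ∑ ρ, ∑ μ, ∑ σ, evalTriple (coordVec χ ρ x) (coordVec χ μ x) (coordVec χ σ x) t •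
      ((coordForm χ ρ x ⊗ₜ[ℂ] coordForm χ μ x) ⊗ₜ[ℂ] coordForm χ σ x) := by
  induction t using TensorProduct.induction_on with
  | zero => simp
  | add s t hs ht =>
    simp only [map_add, add_smul, Finset.sum_add_distrib]
    rw [← hs, ← ht]
  | tmul s ξ =>
    conv_lhs => rw [← sum_coordForm hχ hx ξ, tensor2_eq_sum hχ hx s]
    simp only [TensorProduct.sum_tmul, TensorProduct.tmul_sum, evalTriple_tmul,
      TensorProduct.smul_tmul_smul]
    rw [Finset.sum_comm]
    exact Finset.sum_congr rfl fun _ _ => Finset.sum_comm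

theorem chartAt_mem (x : M) :
    chartAt (EuclideanSpace ℝ (Fin n)) x ∈ IsManifold.maximalAtlas (𝓡 n) ∞ M :=
  IsManifold.chart_mem_maximalAtlas x

theorem tensor2_ext_coord (hχ : χ ∈ IsManifold.maximalAtlas (𝓡 n) ∞ M) (hx : x ∈ χ.source)
    {s t : CotC n x ⊗[ℂ] CotC n x}
    (h : ∀ ν ρ, evalPair (coordVec χ ν x) (coordVec χ ρ x) s =
      evalPair (coordVec χ ν x) (coordVec χ ρ x) t) : s = t := by
  rw [tensor2_eq_sum hχ hx s, tensor2_eq_sum hχ hx t]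
  simp only [h]

theorem tensor2_ext {s t : CotC n x ⊗[ℂ] CotC n x}
    (h : ∀ X Y, evalPair X Y s = evalPair X Y t) : s = t :=
  tensor2_ext_coord (chartAt_mem x) (mem_chart_source _ x) fun _ _ => h _ _

theorem tensor3_ext_coord (hχ : χ ∈ IsManifold.maximalAtlas (𝓡 n) ∞ M) (hx : x ∈ χ.source)
    {s t : (CotC n x ⊗[ℂ] CotC n x) ⊗[ℂ] CotC n x}
    (h : ∀ ρ μ σ, evalTriple (coordVec χ ρ x) (coordVec χ μ x) (coordVec χ σ x) s =
      evalTriple (coordVec χ ρ x) (coordVec χ μ x) (coordVec χ σ x) t) : s = t := by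
  rw [tensor3_eq_sum hχ hx s, tensor3_eq_sum hχ hx t]
  simp only [h]

theorem tensor3_ext {s t : (CotC n x ⊗[ℂ] CotC n x) ⊗[ℂ] CotC n x}
    (h : ∀ X Y Z, evalTriple X Y Z s = evalTriple X Y Z t) : s = t :=
  tensor3_ext_coord (chartAt_mem x) (mem_chart_source _ x) fun _ _ _ => h _ _ _

/-- `t(·, Y)` as a real-linear map. -/
def evalPairLeft (t : CotC n x ⊗[ℂ] CotC n x) (Y : TangentSpace (𝓡 n) x) :
    TangentSpace (𝓡 n) x →ₗ[ℝ] ℂ where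
  toFun X := evalPair X Y t
  map_add' X X' := by
    induction t using TensorProduct.induction_on with
    | zero => simp
    | add s t hs ht => simp only [map_add, hs, ht]; ring
    | tmul η ξ => simp [add_mul]
  map_smul' c X := by
    induction t using TensorProduct.induction_on with
    | zero => simp
    | add s t hs ht => simp only [map_add, hs, ht, smul_add]
    | tmul η ξ => simp [mul_assoc]

/-- `t(X, ·)` as a real-linear map. -/
def evalPairRight (t : CotC n x ⊗[ℂ] CotC n x) (X : TangentSpace (𝓡 n) x) :
    TangentSpace (𝓡 n) x →ₗ[ℝ] ℂ where
  toFun Y := evalPair X Y t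
  map_add' Y Y' := by
    induction t using TensorProduct.induction_on with
    | zero => simp
    | add s t hs ht => simp only [map_add, hs, ht]; ring
    | tmul η ξ => simp [mul_add]
  map_smul' c Y := by
    induction t using TensorProduct.induction_on with
    | zero => simp
    | add s t hs ht => simp only [map_add, hs, ht, smul_add]
    | tmul η ξ => simp [mul_left_comm]

/-- `t(X, Y, ·)` as a real-linear map. -/
def evalTripleRight (t : (CotC n x ⊗[ℂ] CotC n x) ⊗[ℂ] CotC n x)
    (X Y : TangentSpace (𝓡 n) x) : TangentSpace (𝓡 n) x →ₗ[ℝ] ℂ where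
  toFun Z := evalTriple X Y Z t
  map_add' Z Z' := by
    induction t using TensorProduct.induction_on with
    | zero => simp
    | add s t hs ht => simp only [map_add, hs, ht]; ring
    | tmul η ξ => simp [mul_add]
  map_smul' c Z := by
    induction t using TensorProduct.induction_on with
    | zero => simp
    | add s t hs ht => simp only [map_add, hs, ht, smul_add]
    | tmul η ξ => simp [mul_left_comm]

end Evaluation

section MetricEvaluation

variable {n : ℕ} {M : Type*} [TopologicalSpace M] [ChartedSpace (EuclideanSpace ℝ (Fin n)) M]
  [IsManifold (𝓡 n) ∞ M] [Bundle.RiemannianBundle (fun x : M => TangentSpace (𝓡 n) x)]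
  [IsContMDiffRiemannianBundle (𝓡 n) ∞ (EuclideanSpace ℝ (Fin n))
    (fun x : M => TangentSpace (𝓡 n) x)]
variable {x : M}

/-- The orthonormal basis of `T_x M` used to define the inner product of one-forms. -/
abbrev onb (x : M) : OrthonormalBasis (Fin (Module.finrank ℝ (TangentSpace (𝓡 n) x))) ℝ
    (TangentSpace (𝓡 n) x) :=
  stdOrthonormalBasis ℝ (TangentSpace (𝓡 n) x)

theorem pairing_apply (η ξ : OneForm n M) :
    pairing η ξ x = ∑ k, conj (η x (onb x k)) * ξ x (onb x k) := rfl

theorem pairing_conj (η ξ : OneForm n M) : conj (pairing η ξ x) = pairing ξ η x := by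
  simp [pairing_apply, mul_comm]

theorem pairR_apply (η : OneForm n M) (t : T2 n M) (Y : TangentSpace (𝓡 n) x) :
    pairR η t x Y = ∑ k, conj (η x (onb x k)) * val2 t (onb x k) Y := by
  induction t using TensorProduct.induction_on with
  | zero => simp
  | add s t hs ht => simp [hs, ht, mul_add, Finset.sum_add_distrib]
  | tmul ξ ρ =>
    change pairing η ξ x * ρ x Y = _
    simp [pairing_apply, Finset.sum_mul, mul_assoc]

theorem pairL_apply (η : OneForm n M) (t : T2 n M) (Y : TangentSpace (𝓡 n) x) :
    pairL t η x Y = -conj (pairR η t x Y) := rfl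

theorem val2_alphaR (t : T3 n M) (η : OneForm n M) (X Y : TangentSpace (𝓡 n) x) :
    val2 (alphaR t η) X Y = -∑ k, val3 t X Y (onb x k) * η x (onb x k) := by
  induction t using TensorProduct.induction_on with
  | zero => simp
  | add s t hs ht =>
    simp only [map_add, LinearMap.add_apply, val2_add, hs, ht, val3_add, add_mul,
      Finset.sum_add_distrib]
    ring
  | tmul s ξ =>
    have : alphaR (s ⊗ₜ ξ) η = pairing (dagger ξ) η • s := rfl
    rw [this, val2_smul]
    simp [pairing_apply, dagger_apply, Finset.mul_sum, mul_left_comm, mul_comm]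

end MetricEvaluation

/-! ### Real Parseval frames of one-forms -/

section Frames

variable {n : ℕ} {M : Type*} [TopologicalSpace M] [ChartedSpace (EuclideanSpace ℝ (Fin n)) M]
  [IsManifold (𝓡 n) ∞ M] [Bundle.RiemannianBundle (fun x : M => TangentSpace (𝓡 n) x)]
variable {x : M}

/-- A finite family of real one-forms that satisfies the Parseval identity
`∑ p, θ_p(v) θ_p(w) = ⟨v, w⟩` on each tangent space. -/
structure IsParsevalFrame {κ : Type*} [Fintype κ] (θ : κ → OneForm n M) : Prop where
  real : ∀ p (x : M) (v : TangentSpace (𝓡 n) x), conj (θ p x v) = θ p x v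
  parseval : ∀ (x : M) (v w : TangentSpace (𝓡 n) x),
    ∑ p, θ p x v * θ p x w = ((inner ℝ v w : ℝ) : ℂ)

theorem conj_coordForm {χ : OpenPartialHomeomorph M (EuclideanSpace ℝ (Fin n))}
    (hχ : χ ∈ IsManifold.maximalAtlas (𝓡 n) ∞ M) (hx : x ∈ χ.source) (μ : Fin n)
    (v : TangentSpace (𝓡 n) x) : conj (coordForm χ μ x v) = coordForm χ μ x v := by
  have h : (Complex.conjCLE : ℂ →L[ℝ] ℂ).comp (coordForm χ μ x) = coordForm χ μ x := by
    refine cot_ext_coordVec hχ hx fun ν => ?_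
    change conj (coordForm χ μ x (coordVec χ ν x)) = _
    rw [coordForm_coordVec hχ hx]
    split_ifs <;> simp
  exact congrArg (fun T : CotC n x => T v) h

/-- A form is determined by its values on the orthonormal basis of a tangent space. -/
theorem cot_eq_sum_onb (η : CotC n x) (v : TangentSpace (𝓡 n) x) :
    η v = ∑ k, ((inner ℝ (onb x k) v : ℝ) : ℂ) * η (onb x k) := by
  conv_lhs => rw [← (onb x).sum_repr' v]
  simp

/-- An orthonormal family of `n` real covectors satisfies the Parseval identity. -/
theorem parseval_of_orthonormal (e : Fin n → CotC n x)
    (hreal : ∀ j v, conj (e j v) = e j v)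
    (he : ∀ j k, cotInner (e j) (e k) = if j = k then 1 else 0) (v w : TangentSpace (𝓡 n) x) :
    ∑ j, e j v * e j w = ((inner ℝ v w : ℝ) : ℂ) := by
  classical
  let U : Matrix (Fin n) (Fin (Module.finrank ℝ (TangentSpace (𝓡 n) x))) ℂ :=
    Matrix.of fun j k => e j (onb x k)
  -- orthonormality says that the square matrix `U` has a right inverse, Parseval that it has a left
  -- inverse
  have hU : U * U.transpose = 1 := by
    ext j k
    simp only [Matrix.mul_apply, Matrix.transpose_apply, Matrix.one_apply, U, Matrix.of_apply]
    rw [← he j k]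
    simp [cotInner, hreal]
  have hcard : Fintype.card (Fin n) =
      Fintype.card (Fin (Module.finrank ℝ (TangentSpace (𝓡 n) x))) := by
    have : Module.finrank ℝ (TangentSpace (𝓡 n) x) = n := finrank_euclideanSpace_fin (𝕜 := ℝ)
    simp [this]
  have hU' : U.transpose * U = 1 := (Matrix.mul_eq_one_comm_of_card_eq _ _ _ hcard).1 hU
  have hkl : ∀ k l, ∑ j, e j (onb x k) * e j (onb x l) = if k = l then 1 else 0 := fun k l => by
    have := congrFun (congrFun hU' k) l
    simpa [Matrix.mul_apply, Matrix.one_apply, U] using this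
  calc ∑ j, e j v * e j w
      = ∑ j, ∑ k, ∑ l, ((inner ℝ (onb x k) v : ℝ) : ℂ) * ((inner ℝ (onb x l) w : ℝ) : ℂ) *
          (e j (onb x k) * e j (onb x l)) := by
        refine Finset.sum_congr rfl fun j _ => ?_
        rw [cot_eq_sum_onb (e j) v, cot_eq_sum_onb (e j) w, Finset.sum_mul_sum]
        exact Finset.sum_congr rfl fun k _ => Finset.sum_congr rfl fun l _ => by ring
    _ = ∑ k, ∑ l, ((inner ℝ (onb x k) v : ℝ) : ℂ) * ((inner ℝ (onb x l) w : ℝ) : ℂ) *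
          ∑ j, e j (onb x k) * e j (onb x l) := by
        rw [Finset.sum_comm]
        refine Finset.sum_congr rfl fun k _ => ?_
        rw [Finset.sum_comm]
        simp only [Finset.mul_sum]
    _ = ((inner ℝ v w : ℝ) : ℂ) := by
        rw [← (onb x).sum_inner_mul_inner v w]
        simp [hkl, real_inner_comm]

/-- The covector `e^j = ∑ μ, B^j_μ dx^μ` of the coframe on a chart domain. -/
def CoframeData.coframe {ι : Type*} (D : CoframeData n M ι) (α : ι) (j : Fin n) (x : M) :
    CotC n x :=
  ∑ μ, (D.B α j μ x : ℂ) • coordForm (D.chart α) μ x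

variable {ι : Type*} (D : CoframeData n M ι)

theorem CoframeData.coframe_coordVec {α : ι} (hx : x ∈ (D.chart α).source) (j μ : Fin n) :
    D.coframe α j x (coordVec (D.chart α) μ x) = D.B α j μ x := by
  simp [coframe, coordForm_coordVec (D.chart_mem α) hx]

theorem CoframeData.conj_coframe {α : ι} (hx : x ∈ (D.chart α).source) (j : Fin n)
    (v : TangentSpace (𝓡 n) x) : conj (D.coframe α j x v) = D.coframe α j x v := by
  simp [coframe, conj_coordForm (D.chart_mem α) hx]

theorem CoframeData.parseval_coframe {α : ι} (hx : x ∈ (D.chart α).source)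
    (v w : TangentSpace (𝓡 n) x) :
    ∑ j, D.coframe α j x v * D.coframe α j x w = ((inner ℝ v w : ℝ) : ℂ) :=
  parseval_of_orthonormal _ (fun j v => D.conj_coframe hx j v)
    (fun j k => D.orthonormal α x hx j k) v w

theorem CoframeData.frame_apply (p : ι × Fin n) (v : TangentSpace (𝓡 n) x) :
    D.frame p x v = ((√(D.φ p.1 x) : ℝ) : ℂ) * D.coframe p.1 p.2 x v := rfl

theorem CoframeData.mem_source_of_ne_zero {α : ι} (h : D.φ α x ≠ 0) : x ∈ (D.chart α).source :=
  D.subordinate α (subset_tsupport _ h)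

theorem CoframeData.sum_φ [Fintype ι] (x : M) : ∑ α, D.φ α x = 1 := by
  rw [← finsum_eq_sum_of_fintype]
  exact D.φ.sum_eq_one (Set.mem_univ x)

/-- The forms `θ_{jα}`, `α` fixed, satisfy the Parseval identity weighted by `φ_α`. -/
theorem CoframeData.sum_frame_fixed (α : ι) (v w : TangentSpace (𝓡 n) x) :
    ∑ j, D.frame (α, j) x v * D.frame (α, j) x w =
      (D.φ α x : ℂ) * ((inner ℝ v w : ℝ) : ℂ) := by
  by_cases h : D.φ α x = 0
  · simp [frame_apply, h]
  · rw [← D.parseval_coframe (D.mem_source_of_ne_zero h) v w, Finset.mul_sum]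
    refine Finset.sum_congr rfl fun j _ => ?_
    have hs : ((√(D.φ α x) : ℝ) : ℂ) * ((√(D.φ α x) : ℝ) : ℂ) = (D.φ α x : ℂ) := by
      rw [← Complex.ofReal_mul, Real.mul_self_sqrt (D.φ.nonneg α x)]
    simp only [frame_apply]
    rw [← hs]
    ring

theorem CoframeData.isParsevalFrame [Fintype ι] : IsParsevalFrame D.frame where
  real p x v := by
    rw [D.frame_apply]
    by_cases h : D.φ p.1 x = 0
    · simp [h]
    · simp [D.conj_coframe (D.mem_source_of_ne_zero h)]
  parseval x v w := by
    rw [Fintype.sum_prod_type]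
    simp only [D.sum_frame_fixed, ← Finset.sum_mul]
    rw [← Complex.ofReal_sum, D.sum_φ]
    simp

end Frames

section FrameExpansion

variable {n : ℕ} {M : Type*} [TopologicalSpace M] [ChartedSpace (EuclideanSpace ℝ (Fin n)) M]
  [IsManifold (𝓡 n) ∞ M] [Bundle.RiemannianBundle (fun x : M => TangentSpace (𝓡 n) x)]
  [IsContMDiffRiemannianBundle (𝓡 n) ∞ (EuclideanSpace ℝ (Fin n))
    (fun x : M => TangentSpace (𝓡 n) x)]
variable {κ : Type*} [Fintype κ] {θ : κ → OneForm n M}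

namespace IsParsevalFrame

theorem dagger_eq (hθ : IsParsevalFrame θ) (p : κ) : dagger (θ p) = -θ p :=
  OneForm.ext_apply fun x => ContinuousLinearMap.ext fun v => by
    rw [dagger_apply, hθ.real]
    rfl

/-- The reconstruction formula of the frame. -/
theorem sum_pairing_smul (hθ : IsParsevalFrame θ) (η : OneForm n M) :
    ∑ p, pairing (θ p) η • θ p = η := by
  refine OneForm.ext_apply fun x => ContinuousLinearMap.ext fun v => ?_
  have h1 : (∑ p, pairing (θ p) η • θ p) x v = ∑ p, pairing (θ p) η x * θ p x v := by
    change ev1 x (∑ p, pairing (θ p) η • θ p) v = _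
    rw [map_sum]
    simp [map_smulₛₗ]
    rfl
  rw [h1, cot_eq_sum_onb (η x) v]
  simp only [pairing_apply, hθ.real, Finset.sum_mul]
  rw [Finset.sum_comm]
  refine Finset.sum_congr rfl fun k _ => ?_
  rw [← hθ.parseval, Finset.sum_mul]
  exact Finset.sum_congr rfl fun p _ => by ring

/-- The reconstruction formula for two-tensors; it reduces `t = 0` to the vanishing of the one-forms
`⟨θ_p | t⟩`. -/
theorem sum_tmul_pairR (hθ : IsParsevalFrame θ) (t : T2 n M) :
    ∑ p, (θ p ⊗ₜ pairR (θ p) t : T2 n M) = t := by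
  induction t using TensorProduct.induction_on with
  | zero => simp
  | add s t hs ht =>
    simp only [map_add, TensorProduct.tmul_add, Finset.sum_add_distrib, hs, ht]
  | tmul η ξ =>
    conv_rhs => rw [← hθ.sum_pairing_smul η, TensorProduct.sum_tmul]
    refine Finset.sum_congr rfl fun p _ => ?_
    have : pairR (θ p) (η ⊗ₜ ξ) = pairing (θ p) η • ξ := rfl
    rw [this, TensorProduct.tmul_smul, TensorProduct.smul_tmul']

/-- The reconstruction formula for three-tensors; it reduces `t = 0` to the vanishing of the
two-tensors `α(t)(θ_p)`. -/
theorem sum_alphaR_tmul (hθ : IsParsevalFrame θ) (t : T3 n M) :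
    ∑ p, (alphaR t (θ p) ⊗ₜ dagger (θ p) : T3 n M) = t := by
  induction t using TensorProduct.induction_on with
  | zero => simp
  | add s t hs ht =>
    simp only [map_add, LinearMap.add_apply, TensorProduct.add_tmul, Finset.sum_add_distrib,
      hs, ht]
  | tmul s ξ =>
    conv_rhs => rw [← hθ.sum_pairing_smul ξ, TensorProduct.tmul_sum]
    refine Finset.sum_congr rfl fun p _ => ?_
    have h1 : alphaR (s ⊗ₜ ξ) (θ p) = pairing (dagger ξ) (θ p) • s := rfl
    have h2 : pairing (dagger ξ) (θ p) = -pairing (θ p) ξ := Subtype.ext <| funext fun x => by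
      change pairing (dagger ξ) (θ p) x = -(pairing (θ p) ξ x)
      simp [pairing_apply, dagger_apply, hθ.real, mul_comm]
    rw [h1, h2, hθ.dagger_eq, TensorProduct.tmul_neg, neg_smul, TensorProduct.neg_tmul, neg_neg,
      TensorProduct.tmul_smul, TensorProduct.smul_tmul']

theorem tensor2_eq_zero (hθ : IsParsevalFrame θ) {t : T2 n M}
    (h : ∀ (x : M) (X Y : TangentSpace (𝓡 n) x), val2 t X Y = 0) : t = 0 := by
  rw [← hθ.sum_tmul_pairR t]
  refine Finset.sum_eq_zero fun p _ => ?_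
  have : pairR (θ p) t = 0 := OneForm.ext_apply fun x => ContinuousLinearMap.ext fun v => by
    rw [pairR_apply]
    simp [h]
  rw [this, TensorProduct.tmul_zero]

theorem tensor2_ext (hθ : IsParsevalFrame θ) {s t : T2 n M}
    (h : ∀ (x : M) (X Y : TangentSpace (𝓡 n) x), val2 s X Y = val2 t X Y) : s = t :=
  sub_eq_zero.1 (hθ.tensor2_eq_zero fun x X Y => by simp [h])

theorem tensor3_eq_zero (hθ : IsParsevalFrame θ) {t : T3 n M}
    (h : ∀ (x : M) (X Y Z : TangentSpace (𝓡 n) x), val3 t X Y Z = 0) : t = 0 := by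
  rw [← hθ.sum_alphaR_tmul t]
  refine Finset.sum_eq_zero fun p _ => ?_
  have : alphaR t (θ p) = 0 := hθ.tensor2_eq_zero fun x X Y => by
    rw [val2_alphaR]
    simp [h]
  rw [this, TensorProduct.zero_tmul]

end IsParsevalFrame

end FrameExpansion

/-! ### The exterior derivative of one-forms -/

section ExteriorDerivative

variable {n : ℕ} {M : Type*} [TopologicalSpace M] [ChartedSpace (EuclideanSpace ℝ (Fin n)) M]
  [IsManifold (𝓡 n) ∞ M]
variable {x : M} {χ : OpenPartialHomeomorph M (EuclideanSpace ℝ (Fin n))}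

/-- The map `a ⊗ b ↦ a db` on all of `B ⊗ B`. -/
def mulD : SmoothFun n M ⊗[ℂ] SmoothFun n M →ₗ[ℂ] OneForm n M :=
  TensorProduct.lift (LinearMap.mk₂ ℂ (fun a b : SmoothFun n M => a • dFun b)
    (fun a a' b => add_smul a a' _) (fun c a b => smul_assoc c a _)
    (fun a b b' => by rw [map_add, smul_add])
    (fun c a b => by rw [map_smul, smul_comm]))

/-- The map `a ⊗ b ↦ da ⊗ db` on all of `B ⊗ B`. -/
def tensorD : SmoothFun n M ⊗[ℂ] SmoothFun n M →ₗ[ℂ] T2 n M :=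
  TensorProduct.lift (LinearMap.mk₂ ℂ (fun a b : SmoothFun n M => (dFun a ⊗ₜ dFun b : T2 n M))
    (fun a a' b => by rw [map_add, TensorProduct.add_tmul])
    (fun c a b => by rw [map_smul, TensorProduct.smul_tmul'])
    (fun a b b' => by rw [map_add, TensorProduct.tmul_add])
    (fun c a b => by rw [map_smul, TensorProduct.tmul_smul]))

theorem piU_eq_mulD (u : universalForms n M) : piU u = mulD u.1 := rfl

theorem piDelta_eq_tensorD (u : universalForms n M) : piDelta u = tensorD u.1 := rfl

/-- The antisymmetrised coordinate derivative of `∑ a db` is `da ∧ db`, because second partial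
derivatives commute. -/
theorem antisymm_tensorD (hχ : χ ∈ IsManifold.maximalAtlas (𝓡 n) ∞ M) (hx : x ∈ χ.source)
    (w : SmoothFun n M ⊗[ℂ] SmoothFun n M) (ρ μ : Fin n) :
    val2 (tensorD w) (coordVec χ ρ x) (coordVec χ μ x) -
      val2 (tensorD w) (coordVec χ μ x) (coordVec χ ρ x) =
    pd χ ρ (formComp χ (mulD w) μ) x - pd χ μ (formComp χ (mulD w) ρ) x := by
  induction w using TensorProduct.induction_on with
  | zero =>
    have h : ∀ μ, formComp χ (0 : OneForm n M) μ = fun _ => 0 := fun μ => rfl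
    simp [h, pd_const]
  | add s t hs ht =>
    have h : ∀ μ, formComp χ (mulD s + mulD t : OneForm n M) μ =
        fun y => formComp χ (mulD s) μ y + formComp χ (mulD t) μ y := fun μ => rfl
    simp only [map_add, val2_add, h]
    rw [pd_add (diffInChart_formComp hχ hx _ _) (diffInChart_formComp hχ hx _ _),
      pd_add (diffInChart_formComp hχ hx _ _) (diffInChart_formComp hχ hx _ _)]
    linear_combination hs + ht
  | tmul a b =>
    have h : ∀ μ, formComp χ (mulD (a ⊗ₜ b) : OneForm n M) μ =
        fun y => a y * formComp χ (dFun b) μ y := fun μ => rfl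
    have ha : DiffInChart χ a x := diffInChart_of_contMDiffAt hχ hx (a.2 x)
    have h2 : tensorD (a ⊗ₜ b) = dFun a ⊗ₜ[SmoothFun n M] dFun b := rfl
    simp only [h, h2, val2_tmul]
    rw [pd_mul ha (diffInChart_formComp hχ hx _ _) hx,
      pd_mul ha (diffInChart_formComp hχ hx _ _) hx,
      pd_formComp_dFun_comm hχ hx b μ ρ, ← formComp_dFun hχ hx a, ← formComp_dFun hχ hx a]
    simp only [formComp]
    ring

/-- The values of the exterior derivative on coordinate vectors, for forms in the image of `π`; they
do not depend on the preimage chosen in `exteriorD`. For other forms `exteriorD` has the junk value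
`0`; `CoframeData.exists_piU_eq` shows that there are none. -/
theorem val2_exteriorD (hχ : χ ∈ IsManifold.maximalAtlas (𝓡 n) ∞ M) (hx : x ∈ χ.source)
    {η : OneForm n M} (hη : ∃ u : universalForms n M, piU u = η) (ρ μ : Fin n) :
    val2 (exteriorD η) (coordVec χ ρ x) (coordVec χ μ x) =
      (1 / 2) * (pd χ ρ (formComp χ η μ) x - pd χ μ (formComp χ η ρ) x) := by
  have h := antisymm_tensorD hχ hx hη.choose.1 ρ μ
  rw [← piU_eq_mulD, hη.choose_spec] at h
  rw [exteriorD, dif_pos hη, val2_sub, val2_symT2, piDelta_eq_tensorD, ← h]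
  ring

theorem val2_exteriorD_antisymm (η : OneForm n M) (X Y : TangentSpace (𝓡 n) x) :
    val2 (exteriorD η) X Y = -val2 (exteriorD η) Y X := by
  unfold exteriorD
  split_ifs
  · simp only [val2_sub, val2_symT2]
    ring
  · simp

theorem dFun_one : dFun (1 : SmoothFun n M) = 0 :=
  OneForm.ext_apply fun y =>
    (mvfderiv_const (1 : ℂ) : mvfderiv (𝓡 n) (fun _ : M => (1 : ℂ)) y = 0)

/-- A product `a db` is the image under `π` of `a ⊗ b - ab ⊗ 1`, which lies in the kernel of the
multiplication. -/
theorem smul_dFun_mem_range_piU (a b : SmoothFun n M) :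
    a • dFun b ∈ LinearMap.range (piU (n := n) (M := M)) := by
  refine ⟨⟨a ⊗ₜ b - (a * b) ⊗ₜ 1, ?_⟩, ?_⟩
  · simp [universalForms]
  · rw [piU_eq_mulD]
    change mulD (a ⊗ₜ b - (a * b) ⊗ₜ 1) = _
    rw [map_sub]
    change a • dFun b - (a * b) • dFun 1 = _
    rw [dFun_one, smul_zero, sub_zero]

variable [Bundle.RiemannianBundle (fun x : M => TangentSpace (𝓡 n) x)]
variable {ι : Type*} (D : CoframeData n M ι)

/-- The function `√φ_α`. -/
def CoframeData.root (α : ι) : SmoothFun n M :=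
  ⟨fun y => ((√(D.φ α y) : ℝ) : ℂ), fun y =>
    Complex.ofRealCLM.contDiff.contMDiff.contMDiffAt.comp y (D.sqrt_smooth α y)⟩

theorem CoframeData.root_mul_root (α : ι) (y : M) :
    D.root α y * D.root α y = (D.φ α y : ℂ) := by
  change ((√(D.φ α y) : ℝ) : ℂ) * ((√(D.φ α y) : ℝ) : ℂ) = _
  rw [← Complex.ofReal_mul, Real.mul_self_sqrt (D.φ.nonneg α y)]

/-- The product of `√φ_α` with a function that is smooth on the chart domain `U_α` only. -/
def CoframeData.cutoff (α : ι) (f : M → ℂ)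
    (hf : ∀ y ∈ (D.chart α).source, ContMDiffAt (𝓡 n) 𝓘(ℝ, ℂ) ∞ f y) : SmoothFun n M :=
  ⟨fun y => ((√(D.φ α y) : ℝ) : ℂ) * f y, fun y => by
    by_cases hy : y ∈ (D.chart α).source
    · exact contMDiffAt_mul
        (Complex.ofRealCLM.contDiff.contMDiff.contMDiffAt.comp y (D.sqrt_smooth α y)) (hf y hy)
    · have h0 : y ∉ tsupport (D.φ α) := fun h => hy (D.subordinate α h)
      refine (contMDiffAt_const (c := (0 : ℂ))).congr_of_eventuallyEq ?_
      filter_upwards [(isClosed_tsupport _).isOpen_compl.mem_nhds h0] with z hz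
      have : D.φ α z = 0 := image_eq_zero_of_notMem_tsupport hz
      simp [this]⟩

/-- The `α`-th part `φ_α η` of a form, written as a sum of terms `a db` with globally defined
functions: with `s = √φ_α` one has `s² f dx^μ = (s f) d(s x^μ) - (s f x^μ) ds`. -/
theorem CoframeData.smul_eq_sum_smul_dFun (η : OneForm n M) (α : ι) :
    ∃ (a b : Fin n → SmoothFun n M) (c s : SmoothFun n M), ∀ x : M,
      (∑ μ, a μ • dFun (b μ) - c • dFun s : OneForm n M) x = (D.φ α x : ℂ) • η x := by
  have hcoord : ∀ μ, ∀ y ∈ (D.chart α).source,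
      ContMDiffAt (𝓡 n) 𝓘(ℝ, ℂ) ∞ (fun z => ((D.chart α z μ : ℝ) : ℂ)) y :=
    fun μ y hy => contMDiffAt_coordinate (D.chart_mem α) hy μ
  have hcomp : ∀ μ, ∀ y ∈ (D.chart α).source,
      ContMDiffAt (𝓡 n) 𝓘(ℝ, ℂ) ∞ (formComp (D.chart α) η μ) y :=
    fun μ y hy => contMDiffAt_formComp (D.chart_mem α) hy (η.smooth y) μ
  set s : SmoothFun n M := D.root α
  set a : Fin n → SmoothFun n M := fun μ => D.cutoff α (formComp (D.chart α) η μ) (hcomp μ)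
  set b : Fin n → SmoothFun n M :=
    fun μ => D.cutoff α (fun z => ((D.chart α z μ : ℝ) : ℂ)) (hcoord μ)
  set c : SmoothFun n M := ∑ μ, D.cutoff α
    (fun z => formComp (D.chart α) η μ z * ((D.chart α z μ : ℝ) : ℂ))
    (fun y hy => contMDiffAt_mul (hcomp μ y hy) (hcoord μ y hy)) with hc
  refine ⟨a, b, c, s, fun x => ?_⟩
  have hcx : c x = ∑ μ, ((√(D.φ α x) : ℝ) : ℂ) *
      (formComp (D.chart α) η μ x * ((D.chart α x μ : ℝ) : ℂ)) := by
    change evalFun x c = _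
    rw [hc, map_sum]
    rfl
  have hax : ∀ μ, a μ x = ((√(D.φ α x) : ℝ) : ℂ) * formComp (D.chart α) η μ x := fun μ => rfl
  have hsx : ∀ y, s y = ((√(D.φ α y) : ℝ) : ℂ) := fun y => rfl
  have hsum : (∑ μ, a μ • dFun (b μ) - c • dFun s : OneForm n M) x =
      ∑ μ, a μ x • dFun (b μ) x - c x • dFun s x := by
    change ev1 x (∑ μ, a μ • dFun (b μ) - c • dFun s) = _
    rw [map_sub, map_sum]
    simp only [map_smulₛₗ]
    rfl
  rw [hsum]
  by_cases h : D.φ α x = 0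
  · refine ContinuousLinearMap.ext fun v => ?_
    simp [hcx, hax, h]
  have hx := D.mem_source_of_ne_zero h
  refine cot_ext_coordVec (D.chart_mem α) hx fun ν => ?_
  have hdb : ∀ μ, dFun (b μ) x (coordVec (D.chart α) ν x) =
      dFun s x (coordVec (D.chart α) ν x) * ((D.chart α x μ : ℝ) : ℂ) +
        s x * (if μ = ν then 1 else 0) := fun μ => by
    have h1 := formComp_dFun (D.chart_mem α) hx (b μ) ν
    have h2 := formComp_dFun (D.chart_mem α) hx s ν
    have h3 : (b μ : M → ℂ) = fun y => s y * ((D.chart α y μ : ℝ) : ℂ) := by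
      funext y
      rfl
    rw [h3, pd_mul (diffInChart_of_contMDiffAt (D.chart_mem α) hx (s.2 x))
      (diffInChart_of_contMDiffAt (D.chart_mem α) hx (hcoord μ x hx)) hx, ← h2] at h1
    have h4 := coordForm_coordVec (D.chart_mem α) hx μ ν
    rw [coordForm, mvfderiv_coordVec (D.chart_mem α) hx
      ((hcoord μ x hx).mdifferentiableAt (by simp))] at h4
    rw [h4] at h1
    exact h1
  have hss : ((√(D.φ α x) : ℝ) : ℂ) * ((√(D.φ α x) : ℝ) : ℂ) = (D.φ α x : ℂ) :=
    D.root_mul_root α x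
  simp only [sub_apply, sum_apply, smul_apply, smul_eq_mul, hdb, hcx, hax, hsx, Finset.sum_mul]
  rw [← Finset.sum_sub_distrib, ← hss]
  have hterm : ∀ μ, ((√(D.φ α x) : ℝ) : ℂ) * formComp (D.chart α) η μ x *
        (dFun s x (coordVec (D.chart α) ν x) * ((D.chart α x μ : ℝ) : ℂ) +
          ((√(D.φ α x) : ℝ) : ℂ) * (if μ = ν then 1 else 0)) -
      ((√(D.φ α x) : ℝ) : ℂ) * (formComp (D.chart α) η μ x * ((D.chart α x μ : ℝ) : ℂ)) *
        dFun s x (coordVec (D.chart α) ν x) =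
      if μ = ν then ((√(D.φ α x) : ℝ) : ℂ) * ((√(D.φ α x) : ℝ) : ℂ) *
        formComp (D.chart α) η μ x else 0 := fun μ => by
    split_ifs <;> ring
  rw [Finset.sum_congr rfl fun μ _ => hterm μ]
  simp [formComp]

/-- Every one-form is in the image of `π`, so that `exteriorD` is the exterior derivative on all of
`Ω¹`. -/
theorem CoframeData.exists_piU_eq [Fintype ι] (D : CoframeData n M ι) (η : OneForm n M) :
    ∃ u : universalForms n M, piU u = η := by
  choose a b c s h using D.smul_eq_sum_smul_dFun η
  have hη : η = ∑ α, (∑ μ, a α μ • dFun (b α μ) - c α • dFun (s α)) := by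
    refine OneForm.ext_apply fun x => ?_
    change _ = ev1 x (∑ α, (∑ μ, a α μ • dFun (b α μ) - c α • dFun (s α)))
    rw [map_sum]
    have h' : ∀ α, ev1 x (∑ μ, a α μ • dFun (b α μ) - c α • dFun (s α)) =
        (D.φ α x : ℂ) • η x := fun α => h α x
    simp only [h', ← Finset.sum_smul]
    rw [← Complex.ofReal_sum, D.sum_φ, Complex.ofReal_one, one_smul]
  have hmem : η ∈ LinearMap.range (piU (n := n) (M := M)) := by
    rw [hη]
    exact Submodule.sum_mem _ fun α _ => Submodule.sub_mem _
      (Submodule.sum_mem _ fun μ _ => smul_dFun_mem_range_piU _ _) (smul_dFun_mem_range_piU _ _)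
  exact hmem

end ExteriorDerivative

/-! ### The connection form and the connection in a chart -/

section ConnectionForm

variable {n : ℕ} {M : Type*} [TopologicalSpace M] [ChartedSpace (EuclideanSpace ℝ (Fin n)) M]
  [IsManifold (𝓡 n) ∞ M]
variable {κ : Type*} [Fintype κ] {θ : κ → OneForm n M}
variable {x : M} {χ : OpenPartialHomeomorph M (EuclideanSpace ℝ (Fin n))}

theorem val3_tensorW (θ : κ → OneForm n M) (X Y Z : TangentSpace (𝓡 n) x) :
    val3 (tensorW θ) X Y Z = -∑ p, val2 (exteriorD (θ p)) X Y * conj (θ p x Z) := by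
  simp [tensorW, dagger_apply]

theorem val3_tensorW_antisymm (θ : κ → OneForm n M) (X Y Z : TangentSpace (𝓡 n) x) :
    val3 (tensorW θ) X Y Z = -val3 (tensorW θ) Y X Z := by
  simp only [val3_tensorW]
  rw [← Finset.sum_neg_distrib, ← Finset.sum_neg_distrib, ← Finset.sum_neg_distrib]
  exact Finset.sum_congr rfl fun p _ => by rw [val2_exteriorD_antisymm (θ p) X Y]; ring

/-- Since `W` is antisymmetric in its first two arguments, `4 P Q W` has only two terms left. -/
theorem val3_connForm (θ : κ → OneForm n M) (X Y Z : TangentSpace (𝓡 n) x) :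
    val3 (connForm θ) X Y Z =
      val3 (tensorW θ) X Y Z + val3 (tensorW θ) X Z Y + val3 (tensorW θ) Y Z X := by
  rw [connForm, val3_add, val3_nsmul, val3_projP, val3_projQ, val3_projQ,
    val3_tensorW_antisymm θ Y X Z]
  push_cast
  ring

/-- `A` is antisymmetric in its first and last arguments; this makes the connection Hermitian. -/
theorem val3_connForm_antisymm (θ : κ → OneForm n M) (X Y Z : TangentSpace (𝓡 n) x) :
    val3 (connForm θ) X Y Z = -val3 (connForm θ) Z Y X := by
  rw [val3_connForm, val3_connForm, val3_tensorW_antisymm θ Z Y X,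
    val3_tensorW_antisymm θ Z X Y, val3_tensorW_antisymm θ Y X Z]
  ring

/-- The components of `A` in a chart, for a family of real forms with components `θ_{pμ}`. Here
`∑ p, θ_{pμ} θ_{pσ}` takes the place of the metric coefficients. -/
theorem val3_connForm_coordVec (hχ : χ ∈ IsManifold.maximalAtlas (𝓡 n) ∞ M) (hx : x ∈ χ.source)
    (hex : ∀ η : OneForm n M, ∃ u : universalForms n M, piU u = η)
    (hreal : ∀ p (v : TangentSpace (𝓡 n) x), conj (θ p x v) = θ p x v) (ρ μ σ : Fin n) :
    val3 (connForm θ) (coordVec χ ρ x) (coordVec χ μ x) (coordVec χ σ x) =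
      -((1 / 2) * (-pd χ σ (fun y => ∑ p, formComp χ (θ p) μ y * formComp χ (θ p) ρ y) x +
          pd χ μ (fun y => ∑ p, formComp χ (θ p) ρ y * formComp χ (θ p) σ y) x +
          pd χ ρ (fun y => ∑ p, formComp χ (θ p) σ y * formComp χ (θ p) μ y) x) -
        ∑ p, pd χ μ (formComp χ (θ p) ρ) x * formComp χ (θ p) σ x) := by
  have hW : ∀ ρ μ σ, val3 (tensorW θ) (coordVec χ ρ x) (coordVec χ μ x) (coordVec χ σ x) =
      -((1 / 2) * (∑ p, pd χ ρ (formComp χ (θ p) μ) x * formComp χ (θ p) σ x -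
        ∑ p, pd χ μ (formComp χ (θ p) ρ) x * formComp χ (θ p) σ x)) := by
    intro ρ μ σ
    rw [val3_tensorW, ← Finset.sum_sub_distrib, Finset.mul_sum]
    congr 1
    refine Finset.sum_congr rfl fun p _ => ?_
    rw [val2_exteriorD hχ hx (hex _), hreal]
    simp only [formComp]
    ring
  have hH : ∀ ρ μ σ, pd χ ρ (fun y => ∑ p, formComp χ (θ p) μ y * formComp χ (θ p) σ y) x =
      ∑ p, pd χ ρ (formComp χ (θ p) μ) x * formComp χ (θ p) σ x +
        ∑ p, pd χ ρ (formComp χ (θ p) σ) x * formComp χ (θ p) μ x := by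
    intro ρ μ σ
    rw [pd_sum fun p _ => (diffInChart_formComp hχ hx (θ p) μ).mul
      (diffInChart_formComp hχ hx (θ p) σ), ← Finset.sum_add_distrib]
    refine Finset.sum_congr rfl fun p _ => ?_
    rw [pd_mul (diffInChart_formComp hχ hx (θ p) μ) (diffInChart_formComp hχ hx (θ p) σ) hx]
    ring
  rw [val3_connForm, hW, hW, hW, hH, hH, hH]
  ring

end ConnectionForm

section Connection

variable {n : ℕ} {M : Type*} [TopologicalSpace M] [ChartedSpace (EuclideanSpace ℝ (Fin n)) M]
  [IsManifold (𝓡 n) ∞ M] [Bundle.RiemannianBundle (fun x : M => TangentSpace (𝓡 n) x)]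
  [IsContMDiffRiemannianBundle (𝓡 n) ∞ (EuclideanSpace ℝ (Fin n))
    (fun x : M => TangentSpace (𝓡 n) x)]
variable {κ : Type*} [Fintype κ] {θ : κ → OneForm n M}
variable {x : M} {χ : OpenPartialHomeomorph M (EuclideanSpace ℝ (Fin n))}

theorem gLow_symm (μ ν : Fin n) : gLow χ μ ν = gLow χ ν μ :=
  funext fun _ => real_inner_comm _ _

theorem gUp_symm (μ ν : Fin n) : gUp χ μ ν x = gUp χ ν μ x := by
  have h : (Matrix.of fun i j => gLow χ i j x).transpose = Matrix.of fun i j => gLow χ i j x := by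
    ext i j
    simp [gLow_symm (χ := χ) i j]
  have h2 := congrFun (congrFun (Matrix.transpose_nonsing_inv
    (Matrix.of fun i j => gLow χ i j x)) ν) μ
  rw [h] at h2
  exact h2

theorem contMDiffAt_gLow (hχ : χ ∈ IsManifold.maximalAtlas (𝓡 n) ∞ M) (hx : x ∈ χ.source)
    (μ ν : Fin n) : ContMDiffAt (𝓡 n) 𝓘(ℝ, ℝ) ∞ (gLow χ μ ν) x :=
  ContMDiffAt.inner_bundle (IB := 𝓡 n) (contMDiffAt_coordVec hχ hx μ)
    (contMDiffAt_coordVec hχ hx ν)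

/-- The inner product of one-forms, in the coordinates of a chart. -/
theorem sum_onb_eq_gUp (hχ : χ ∈ IsManifold.maximalAtlas (𝓡 n) ∞ M) (hx : x ∈ χ.source)
    (η ξ : CotC n x) :
    ∑ k, conj (η (onb x k)) * ξ (onb x k) =
      ∑ σ, ∑ τ, (gUp χ σ τ x : ℂ) * (conj (η (coordVec χ σ x)) * ξ (coordVec χ τ x)) := by
  have h := sum_gram_inv (onb x) (coordBasis hχ hx) η ξ
  simp only [coordBasis_apply] at h
  exact h

theorem val2_grassmann (hχ : χ ∈ IsManifold.maximalAtlas (𝓡 n) ∞ M) (hx : x ∈ χ.source)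
    (θ : κ → OneForm n M) (η : OneForm n M) (X : TangentSpace (𝓡 n) x) (ρ : Fin n) :
    val2 (grassmann θ η) X (coordVec χ ρ x) =
      ∑ p, θ p x X * pd χ ρ (pairing (θ p) η) x := by
  have h : grassmann θ η = ∑ p, θ p ⊗ₜ dFun (pairing (θ p) η) := by
    simp [grassmann]
  rw [h, val2_sum]
  refine Finset.sum_congr rfl fun p _ => ?_
  rw [val2_tmul, ← formComp_dFun hχ hx]
  rfl

namespace IsParsevalFrame

theorem sum_formComp_mul (hθ : IsParsevalFrame θ) (μ ν : Fin n) (y : M) :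
    ∑ p, formComp χ (θ p) μ y * formComp χ (θ p) ν y = ((gLow χ μ ν y : ℝ) : ℂ) :=
  hθ.parseval y _ _

theorem pd_sum_formComp_mul (hχ : χ ∈ IsManifold.maximalAtlas (𝓡 n) ∞ M) (hx : x ∈ χ.source)
    (hθ : IsParsevalFrame θ) (μ ν ρ : Fin n) :
    pd χ ρ (fun y => ∑ p, formComp χ (θ p) μ y * formComp χ (θ p) ν y) x =
      ((pd χ ρ (gLow χ μ ν) x : ℝ) : ℂ) := by
  simp only [hθ.sum_formComp_mul]
  exact pd_clm_comp Complex.ofRealCLM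
    (diffInChart_of_contMDiffAt hχ hx (contMDiffAt_gLow hχ hx μ ν)) ρ

/-- The components of `∇^v η - α(A) η` in a chart. The derivatives of the frame cancel: what is left
of them is `∂_ρ (∑ p, θ_{pν} ⟨θ_p | η⟩) = ∂_ρ η_ν`. -/
theorem val2_connection (hχ : χ ∈ IsManifold.maximalAtlas (𝓡 n) ∞ M) (hx : x ∈ χ.source)
    (hθ : IsParsevalFrame θ) (hex : ∀ η : OneForm n M, ∃ u : universalForms n M, piU u = η)
    (η : OneForm n M) (ν ρ : Fin n) :
    val2 (grassmann θ η - alphaR (connForm θ) η) (coordVec χ ν x) (coordVec χ ρ x) =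
      pd χ ρ (formComp χ η ν) x -
        ∑ τ, formComp χ η τ x * ((christoffel χ τ ρ ν x : ℝ) : ℂ) := by
  have hη : formComp χ η ν = fun y => ∑ p, formComp χ (θ p) ν y * pairing (θ p) η y := by
    funext y
    have h : formComp χ η ν y =
        ev1 y (∑ p, pairing (θ p) η • θ p) (coordVec χ ν y) := by
      rw [hθ.sum_pairing_smul]
      rfl
    rw [h, map_sum, sum_apply]
    exact Finset.sum_congr rfl fun p _ => mul_comm _ _
  have hpair : ∀ p, DiffInChart χ (pairing (θ p) η) x := fun p =>
    diffInChart_of_contMDiffAt hχ hx ((pairing (θ p) η).2 x)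
  have hpd : pd χ ρ (formComp χ η ν) x =
      ∑ p, pd χ ρ (formComp χ (θ p) ν) x * pairing (θ p) η x +
        ∑ p, formComp χ (θ p) ν x * pd χ ρ (pairing (θ p) η) x := by
    rw [hη, pd_sum fun p _ => (diffInChart_formComp hχ hx (θ p) ν).mul (hpair p),
      ← Finset.sum_add_distrib]
    exact Finset.sum_congr rfl fun p _ =>
      pd_mul (diffInChart_formComp hχ hx (θ p) ν) (hpair p) hx ρ
  -- the third argument of `A`, contracted with `η` through the inverse metric
  have hA : val2 (alphaR (connForm θ) η) (coordVec χ ν x) (coordVec χ ρ x) =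
      -∑ σ, ∑ τ, (gUp χ σ τ x : ℂ) * (val3 (connForm θ) (coordVec χ ν x) (coordVec χ ρ x)
        (coordVec χ σ x) * formComp χ η τ x) := by
    rw [val2_alphaR]
    let L : CotC n x := LinearMap.toContinuousLinearMap
      (evalTripleRight (ev3 x (connForm θ)) (coordVec χ ν x) (coordVec χ ρ x))
    have h := sum_onb_eq_gUp hχ hx ((Complex.conjCLE : ℂ →L[ℝ] ℂ).comp L) (η x)
    have hL : ∀ Z, conj (((Complex.conjCLE : ℂ →L[ℝ] ℂ).comp L) Z) =
        val3 (connForm θ) (coordVec χ ν x) (coordVec χ ρ x) Z := fun Z =>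
      Complex.conj_conj _
    simp only [hL] at h
    rw [h]
    rfl
  -- the part of `A` that contains derivatives of the frame
  have hS : ∑ σ, ∑ τ, (gUp χ σ τ x : ℂ) *
        ((∑ p, pd χ ρ (formComp χ (θ p) ν) x * formComp χ (θ p) σ x) * formComp χ η τ x) =
      ∑ p, pd χ ρ (formComp χ (θ p) ν) x * pairing (θ p) η x := by
    have hp : ∀ p, pairing (θ p) η x = ∑ σ, ∑ τ, (gUp χ σ τ x : ℂ) *
        (formComp χ (θ p) σ x * formComp χ η τ x) := fun p => by
      rw [pairing_apply, sum_onb_eq_gUp hχ hx]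
      simp only [hθ.real]
      rfl
    simp only [hp, Finset.mul_sum, Finset.sum_mul]
    symm
    refine Finset.sum_comm.trans (Finset.sum_congr rfl fun σ _ => ?_)
    refine Finset.sum_comm.trans (Finset.sum_congr rfl fun τ _ => ?_)
    exact Finset.sum_congr rfl fun p _ => by ring
  -- the remaining part of `A`, which contains derivatives of the metric only
  have hΓ : ∑ τ, formComp χ η τ x * ((christoffel χ τ ρ ν x : ℝ) : ℂ) =
      ∑ σ, ∑ τ, (gUp χ σ τ x : ℂ) * ((1 / 2) * (-((pd χ σ (gLow χ ρ ν) x : ℝ) : ℂ) +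
        ((pd χ ρ (gLow χ ν σ) x : ℝ) : ℂ) + ((pd χ ν (gLow χ σ ρ) x : ℝ) : ℂ)) *
          formComp χ η τ x) := by
    rw [Finset.sum_comm]
    refine Finset.sum_congr rfl fun τ _ => ?_
    rw [christoffel]
    push_cast
    rw [Finset.mul_sum, Finset.mul_sum]
    refine Finset.sum_congr rfl fun σ _ => ?_
    rw [gUp_symm τ σ, gLow_symm σ ν]
    ring
  rw [val2_sub, hA, val2_grassmann hχ hx, hpd, hΓ, ← hS]
  simp only [val3_connForm_coordVec hχ hx hex (fun p v => hθ.real p x v),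
    hθ.pd_sum_formComp_mul hχ hx]
  simp only [mul_neg, neg_mul, sub_mul, mul_sub, Finset.sum_neg_distrib, Finset.sum_sub_distrib]
  simp only [formComp]
  ring

end IsParsevalFrame

end Connection

/-! ### The Levi-Civita property and uniqueness -/

section LeviCivita

variable {n : ℕ} {M : Type*} [TopologicalSpace M] [ChartedSpace (EuclideanSpace ℝ (Fin n)) M]
  [IsManifold (𝓡 n) ∞ M] [Bundle.RiemannianBundle (fun x : M => TangentSpace (𝓡 n) x)]
  [IsContMDiffRiemannianBundle (𝓡 n) ∞ (EuclideanSpace ℝ (Fin n))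
    (fun x : M => TangentSpace (𝓡 n) x)]
variable {κ : Type*} [Fintype κ] {θ : κ → OneForm n M}
variable {x : M} {χ : OpenPartialHomeomorph M (EuclideanSpace ℝ (Fin n))}

theorem pd_conj {f : M → ℂ} (hf : DiffInChart χ f x) (ρ : Fin n) :
    pd χ ρ (fun y => conj (f y)) x = conj (pd χ ρ f x) :=
  pd_clm_comp (Complex.conjCLE : ℂ →L[ℝ] ℂ) hf ρ

theorem pd_neg {f : M → ℂ} (hf : DiffInChart χ f x) (ρ : Fin n) :
    pd χ ρ (fun y => -f y) x = -pd χ ρ f x :=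
  pd_clm_comp (-ContinuousLinearMap.id ℝ ℂ) hf ρ

theorem christoffel_symm (ν μ ρ : Fin n) : christoffel χ ν μ ρ x = christoffel χ ν ρ μ x := by
  unfold christoffel
  congr 1
  refine Finset.sum_congr rfl fun σ _ => ?_
  rw [gLow_symm μ ρ]
  ring

/-- A two-tensor that is real on pairs of coordinate vectors is real on all tangent vectors. -/
theorem conj_evalPair (hχ : χ ∈ IsManifold.maximalAtlas (𝓡 n) ∞ M) (hx : x ∈ χ.source)
    {t : CotC n x ⊗[ℂ] CotC n x}
    (h : ∀ ν ρ, conj (evalPair (coordVec χ ν x) (coordVec χ ρ x) t) =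
      evalPair (coordVec χ ν x) (coordVec χ ρ x) t) (X Y : TangentSpace (𝓡 n) x) :
    conj (evalPair X Y t) = evalPair X Y t := by
  have h1 : ∀ ρ, (Complex.conjCLE : ℂ →L[ℝ] ℂ).toLinearMap ∘ₗ evalPairLeft t (coordVec χ ρ x) =
      evalPairLeft t (coordVec χ ρ x) := fun ρ =>
    (coordBasis hχ hx).ext fun ν => by
      rw [coordBasis_apply]
      exact h ν ρ
  have h2 : (Complex.conjCLE : ℂ →L[ℝ] ℂ).toLinearMap ∘ₗ evalPairRight t X =
      evalPairRight t X := (coordBasis hχ hx).ext fun ρ => by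
    rw [coordBasis_apply]
    exact congrArg (fun T : TangentSpace (𝓡 n) x →ₗ[ℝ] ℂ => T X) (h1 ρ)
  exact congrArg (fun T : TangentSpace (𝓡 n) x →ₗ[ℝ] ℂ => T Y) h2

/-- The map `∇ = ∇^v - α(A)`, as a `ℂ`-linear map. -/
def frameConnection (θ : κ → OneForm n M) : OneForm n M →ₗ[ℂ] T2 n M :=
  grassmann θ - (alphaR (connForm θ)).restrictScalars ℂ

theorem frameConnection_apply (θ : κ → OneForm n M) (η : OneForm n M) :
    frameConnection θ η = grassmann θ η - alphaR (connForm θ) η := rfl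

/-- The two parts of `⟨η | ∇ ξ⟩`: the Grassmann connection and the connection form. -/
theorem pairR_frameConnection (hχ : χ ∈ IsManifold.maximalAtlas (𝓡 n) ∞ M) (hx : x ∈ χ.source)
    (θ : κ → OneForm n M) (η ξ : OneForm n M) (ρ : Fin n) :
    pairR η (frameConnection θ ξ) x (coordVec χ ρ x) =
      ∑ p, conj (pairing (θ p) η x) * pd χ ρ (pairing (θ p) ξ) x +
        ∑ k, ∑ l, conj (η x (onb x k)) *
          (val3 (connForm θ) (onb x k) (coordVec χ ρ x) (onb x l) * ξ x (onb x l)) := by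
  rw [pairR_apply]
  simp only [frameConnection_apply, val2_sub, val2_grassmann hχ hx, val2_alphaR, sub_neg_eq_add,
    mul_add, Finset.sum_add_distrib, Finset.mul_sum]
  congr 1
  rw [Finset.sum_comm]
  refine Finset.sum_congr rfl fun p _ => ?_
  rw [pairing_conj, pairing_apply, Finset.sum_mul]
  exact Finset.sum_congr rfl fun k _ => by ring

namespace IsParsevalFrame

/-- Two-tensors are determined by their components in the preferred chart at each point. -/
theorem tensor2_ext_chartAt (hθ : IsParsevalFrame θ) {s t : T2 n M}
    (h : ∀ (x : M) (ν ρ : Fin n),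
      val2 s (coordVec (chartAt (EuclideanSpace ℝ (Fin n)) x) ν x)
        (coordVec (chartAt (EuclideanSpace ℝ (Fin n)) x) ρ x) =
      val2 t (coordVec (chartAt (EuclideanSpace ℝ (Fin n)) x) ν x)
        (coordVec (chartAt (EuclideanSpace ℝ (Fin n)) x) ρ x)) : s = t :=
  hθ.tensor2_ext fun x X Y => by
    rw [val2, val2, tensor2_ext_coord (chartAt_mem x) (mem_chart_source _ x)
      (s := ev2 x s) (t := ev2 x t) (h x)]

/-- `A` is real: the frame consists of real forms. -/
theorem conj_val3_connForm (hθ : IsParsevalFrame θ)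
    (hex : ∀ η : OneForm n M, ∃ u : universalForms n M, piU u = η)
    (X Y Z : TangentSpace (𝓡 n) x) :
    conj (val3 (connForm θ) X Y Z) = val3 (connForm θ) X Y Z := by
  have hχ := chartAt_mem (n := n) x
  have hx := mem_chart_source (EuclideanSpace ℝ (Fin n)) x
  have hpd : ∀ p ρ μ, conj (pd (chartAt (EuclideanSpace ℝ (Fin n)) x) ρ
      (formComp (chartAt (EuclideanSpace ℝ (Fin n)) x) (θ p) μ) x) =
      pd (chartAt (EuclideanSpace ℝ (Fin n)) x) ρ
      (formComp (chartAt (EuclideanSpace ℝ (Fin n)) x) (θ p) μ) x := fun p ρ μ => by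
    rw [← pd_conj (diffInChart_formComp hχ hx _ _)]
    simp only [formComp, hθ.real]
    rfl
  have hd : ∀ p (X Y : TangentSpace (𝓡 n) x),
      conj (val2 (exteriorD (θ p)) X Y) = val2 (exteriorD (θ p)) X Y := fun p =>
    conj_evalPair hχ hx fun ν ρ => by
      have h := val2_exteriorD hχ hx (hex (θ p)) ν ρ
      unfold val2 at h
      rw [h]
      simp [hpd, map_ofNat (starRingEnd ℂ) 2]
  have hW : ∀ X Y Z : TangentSpace (𝓡 n) x,
      conj (val3 (tensorW θ) X Y Z) = val3 (tensorW θ) X Y Z := fun X Y Z => by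
    simp [val3_tensorW, hd, hθ.real]
  simp [val3_connForm, hW]

theorem pairing_eq_sum (hθ : IsParsevalFrame θ) (η ξ : OneForm n M) (y : M) :
    pairing η ξ y = ∑ p, conj (pairing (θ p) η y) * pairing (θ p) ξ y := by
  conv_lhs => rw [← hθ.sum_pairing_smul ξ]
  rw [map_sum]
  change evalFun y (∑ p, pairing η (pairing (θ p) ξ • θ p)) = _
  rw [map_sum]
  refine Finset.sum_congr rfl fun p _ => ?_
  rw [map_smul, smul_eq_mul, map_mul, pairing_conj, mul_comm]
  rfl

theorem frameConnection_hermitian (hθ : IsParsevalFrame θ)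
    (hex : ∀ η : OneForm n M, ∃ u : universalForms n M, piU u = η) (η ξ : OneForm n M) :
    dFun (pairing η ξ) =
      pairR η (frameConnection θ ξ) - pairL (frameConnection θ η) ξ := by
  refine OneForm.ext_apply fun x => ?_
  have hχ := chartAt_mem (n := n) x
  have hx := mem_chart_source (EuclideanSpace ℝ (Fin n)) x
  refine cot_ext_coordVec hχ hx fun ρ => ?_
  have h0 : ∀ α β : OneForm n M, (α - β) x = α x - β x := fun α β => by
    change ev1 x (α - β) = _
    rw [map_sub]
    rfl
  have hpair : ∀ α β : OneForm n M,
      DiffInChart (chartAt (EuclideanSpace ℝ (Fin n)) x) (pairing α β) x := fun α β =>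
    diffInChart_of_contMDiffAt hχ hx ((pairing α β).2 x)
  have hconj : ∀ α β : OneForm n M, DiffInChart (chartAt (EuclideanSpace ℝ (Fin n)) x)
      (fun y => conj (pairing α β y)) x := fun α β => by
    simp only [pairing_conj]
    exact hpair β α
  have hfun : (pairing η ξ : M → ℂ) =
      fun y => ∑ p, conj (pairing (θ p) η y) * pairing (θ p) ξ y :=
    funext fun y => hθ.pairing_eq_sum η ξ y
  have hl := formComp_dFun hχ hx (pairing η ξ) ρ
  rw [hfun, pd_sum fun p _ => (hconj (θ p) η).mul (hpair (θ p) ξ)] at hl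
  refine hl.trans ?_
  rw [h0, sub_apply, pairL_apply, pairR_frameConnection hχ hx,
    pairR_frameConnection hχ hx]
  simp only [map_add, map_sum, map_mul, Complex.conj_conj, hθ.conj_val3_connForm hex]
  -- the connection form drops out, since it is real and antisymmetric in the outer arguments
  have hA : ∑ k, ∑ l, ξ x (onb x k) * (val3 (connForm θ) (onb x k)
        (coordVec (chartAt (EuclideanSpace ℝ (Fin n)) x) ρ x) (onb x l) *
          conj (η x (onb x l))) =
      -∑ k, ∑ l, conj (η x (onb x k)) * (val3 (connForm θ) (onb x k)
        (coordVec (chartAt (EuclideanSpace ℝ (Fin n)) x) ρ x) (onb x l) *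
          ξ x (onb x l)) := by
    rw [Finset.sum_comm, ← Finset.sum_neg_distrib]
    refine Finset.sum_congr rfl fun k _ => ?_
    rw [← Finset.sum_neg_distrib]
    refine Finset.sum_congr rfl fun l _ => ?_
    rw [val3_connForm_antisymm]
    ring
  rw [hA, Finset.sum_congr rfl fun p _ => pd_mul (hconj (θ p) η) (hpair (θ p) ξ) hx ρ,
    Finset.sum_add_distrib]
  simp only [pd_conj (hpair _ _), mul_comm (conj (pd _ _ _ _))]
  ring

theorem isLeviCivita_frameConnection (hθ : IsParsevalFrame θ)
    (hex : ∀ η : OneForm n M, ∃ u : universalForms n M, piU u = η) :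
    IsLeviCivita (frameConnection θ) where
  leibniz η b := hθ.tensor2_ext_chartAt fun x ν ρ => by
    have hχ := chartAt_mem (n := n) x
    have hx := mem_chart_source (EuclideanSpace ℝ (Fin n)) x
    rw [val2_add, val2_smul, val2_tmul, frameConnection_apply, frameConnection_apply,
      hθ.val2_connection hχ hx hex, hθ.val2_connection hχ hx hex]
    have h1 : ∀ τ, formComp (chartAt (EuclideanSpace ℝ (Fin n)) x) (b • η : OneForm n M) τ =
        fun y => b y * formComp (chartAt (EuclideanSpace ℝ (Fin n)) x) η τ y := fun τ => rfl
    have h2 := formComp_dFun hχ hx b ρ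
    rw [formComp] at h2
    simp only [h1]
    rw [h2, pd_mul (diffInChart_of_contMDiffAt hχ hx (b.2 x)) (diffInChart_formComp hχ hx η ν) hx]
    simp only [mul_sub, Finset.mul_sum, formComp, mul_assoc]
    ring
  hermitian := hθ.frameConnection_hermitian hex
  torsionFree η := hθ.tensor2_ext_chartAt fun x ν ρ => by
    have hχ := chartAt_mem (n := n) x
    have hx := mem_chart_source (EuclideanSpace ℝ (Fin n)) x
    rw [val2_add, val2_sub, val2_symT2, val2_zero, frameConnection_apply,
      hθ.val2_connection hχ hx hex, hθ.val2_connection hχ hx hex, val2_exteriorD hχ hx (hex η)]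
    simp only [christoffel_symm _ ν ρ]
    ring
  bimodule η := hθ.tensor2_ext_chartAt fun x ν ρ => by
    have hχ := chartAt_mem (n := n) x
    have hx := mem_chart_source (EuclideanSpace ℝ (Fin n)) x
    rw [val2_neg, val2_flipT2, val2_daggerT2, frameConnection_apply, frameConnection_apply,
      hθ.val2_connection hχ hx hex, hθ.val2_connection hχ hx hex]
    have h1 : ∀ τ, formComp (chartAt (EuclideanSpace ℝ (Fin n)) x) (dagger η) τ =
        fun y => -conj (formComp (chartAt (EuclideanSpace ℝ (Fin n)) x) η τ y) := fun τ => rfl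
    have h2 : DiffInChart (chartAt (EuclideanSpace ℝ (Fin n)) x)
        (fun y => conj (formComp (chartAt (EuclideanSpace ℝ (Fin n)) x) η ρ y)) x :=
      (Complex.conjCLE : ℂ →L[ℝ] ℂ).differentiableAt.comp _ (diffInChart_formComp hχ hx η ρ)
    simp only [h1]
    rw [pd_neg h2, pd_conj (diffInChart_formComp hχ hx η ρ)]
    simp
    ring

/-- The difference of two Levi-Civita connections vanishes: its components `C p q r` in the frame
are real, symmetric in the last two and antisymmetric in the first two indices. -/
theorem leviCivita_unique (hθ : IsParsevalFrame θ) {N₁ N₂ : OneForm n M →ₗ[ℂ] T2 n M}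
    (h₁ : IsLeviCivita N₁) (h₂ : IsLeviCivita N₂) : N₁ = N₂ := by
  set T : OneForm n M →ₗ[ℂ] T2 n M := N₁ - N₂ with hT
  have hsmul : ∀ (b : SmoothFun n M) η, T (b • η) = b • T η := fun b η => by
    simp only [hT, LinearMap.sub_apply, h₁.leibniz, h₂.leibniz, smul_sub]
    abel
  have hsymm : ∀ η (x : M) (X Y : TangentSpace (𝓡 n) x),
      val2 (T η) X Y = val2 (T η) Y X := fun η x X Y => by
    have e₁ := congrArg (fun t => val2 t X Y) (h₁.torsionFree η)
    have e₂ := congrArg (fun t => val2 t X Y) (h₂.torsionFree η)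
    simp only [val2_add, val2_sub, val2_symT2, val2_zero] at e₁ e₂
    simp only [hT, LinearMap.sub_apply, val2_sub]
    linear_combination 2 * e₁ - 2 * e₂
  have hreal : ∀ p (x : M) (X Y : TangentSpace (𝓡 n) x),
      conj (val2 (T (θ p)) X Y) = val2 (T (θ p)) X Y := fun p x X Y => by
    have e₁ := congrArg (fun t => val2 t Y X) (h₁.bimodule (θ p))
    have e₂ := congrArg (fun t => val2 t Y X) (h₂.bimodule (θ p))
    simp only [hθ.dagger_eq, map_neg, val2_flipT2, val2_daggerT2, neg_neg] at e₁ e₂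
    simp only [hT, LinearMap.sub_apply, val2_sub, map_sub, ← e₁, ← e₂]
  have hherm : ∀ p q (x : M) (Y : TangentSpace (𝓡 n) x),
      pairR (θ q) (T (θ p)) x Y = -pairR (θ p) (T (θ q)) x Y := fun p q x Y => by
    have e : pairR (θ q) (T (θ p)) = pairL (T (θ q)) (θ p) := by
      have e₁ := h₁.hermitian (θ q) (θ p)
      have e₂ := h₂.hermitian (θ q) (θ p)
      rw [e₁] at e₂
      simp only [hT, LinearMap.sub_apply, map_sub, pairL] at e₂ ⊢
      rw [sub_eq_sub_iff_sub_eq_sub] at e₂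
      exact e₂
    rw [e, pairL_apply, pairR_apply]
    simp [hreal, hθ.real]
  let C : κ → κ → κ → M → ℂ := fun p q r x => pairing (θ r) (pairR (θ q) (T (θ p))) x
  have hC₁ : ∀ p q r x, C p q r x = -C q p r x := fun p q r x => by
    simp only [C, pairing_apply, hherm p q, mul_neg, Finset.sum_neg_distrib]
  have hC₂ : ∀ p q r x, C p q r x = C p r q x := fun p q r x => by
    simp only [C, pairing_apply, pairR_apply, Finset.mul_sum]
    rw [Finset.sum_comm]
    refine Finset.sum_congr rfl fun k _ => Finset.sum_congr rfl fun l _ => ?_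
    rw [hsymm]
    ring
  have hC : ∀ p q r x, C p q r x = 0 := fun p q r x => by
    have h : C p q r x = -C p q r x := by
      calc C p q r x = -C q p r x := hC₁ _ _ _ _
        _ = -C q r p x := by rw [hC₂ q p r]
        _ = C r q p x := by rw [hC₁ q r p, neg_neg]
        _ = C r p q x := hC₂ _ _ _ _
        _ = -C p r q x := hC₁ _ _ _ _
        _ = -C p q r x := by rw [hC₂ p r q]
    exact self_eq_neg.1 h
  -- the frame reconstructs `T (θ p)` from the `C p q r`, and every form from the `θ p`
  have hθ0 : ∀ p, T (θ p) = 0 := fun p => by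
    rw [← hθ.sum_tmul_pairR (T (θ p))]
    refine Finset.sum_eq_zero fun q _ => ?_
    have h : pairR (θ q) (T (θ p)) = 0 := by
      rw [← hθ.sum_pairing_smul (pairR (θ q) (T (θ p)))]
      refine Finset.sum_eq_zero fun r _ => ?_
      have : pairing (θ r) (pairR (θ q) (T (θ p))) = 0 := Subtype.ext (funext fun x => hC p q r x)
      rw [this, zero_smul]
    rw [h, TensorProduct.tmul_zero]
  have hT0 : T = 0 := LinearMap.ext fun η => by
    rw [← hθ.sum_pairing_smul η, map_sum]
    exact Finset.sum_eq_zero fun p _ => by rw [hsmul, hθ0, smul_zero]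
  exact sub_eq_zero.1 hT0

theorem isLeviCivita_iff (hθ : IsParsevalFrame θ)
    (hex : ∀ η : OneForm n M, ∃ u : universalForms n M, piU u = η)
    (N : OneForm n M →ₗ[ℂ] T2 n M) :
    IsLeviCivita N ↔ ∀ η, N η = grassmann θ η - alphaR (connForm θ) η := by
  constructor
  · intro h η
    rw [hθ.leviCivita_unique h (hθ.isLeviCivita_frameConnection hex), frameConnection_apply]
  · intro h
    have : N = frameConnection θ := LinearMap.ext h
    rw [this]
    exact hθ.isLeviCivita_frameConnection hex

end IsParsevalFrame

end LeviCivita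

/-! ### The connection form in the charts of the frame -/

section LocalForm

variable {n : ℕ} {M : Type*} [TopologicalSpace M] [ChartedSpace (EuclideanSpace ℝ (Fin n)) M]
  [IsManifold (𝓡 n) ∞ M] [Bundle.RiemannianBundle (fun x : M => TangentSpace (𝓡 n) x)]
  [IsContMDiffRiemannianBundle (𝓡 n) ∞ (EuclideanSpace ℝ (Fin n))
    (fun x : M => TangentSpace (𝓡 n) x)]
variable {κ : Type*} [Fintype κ] {θ : κ → OneForm n M}
variable {x : M} {χ : OpenPartialHomeomorph M (EuclideanSpace ℝ (Fin n))}

/-- The three-tensor `(X, Y, Z) ↦ η(X) ⟨Y, Z⟩ - ⟨X, Y⟩ η(Z)`, written with a Parseval frame. -/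
def metricWedge (θ : κ → OneForm n M) (η : OneForm n M) : T3 n M :=
  ∑ p, (((η ⊗ₜ θ p : T2 n M) ⊗ₜ θ p : T3 n M) + ((θ p ⊗ₜ θ p : T2 n M) ⊗ₜ (-η) : T3 n M))

theorem IsParsevalFrame.val3_metricWedge (hθ : IsParsevalFrame θ) (η : OneForm n M)
    (X Y Z : TangentSpace (𝓡 n) x) :
    val3 (metricWedge θ η) X Y Z = η x X * ((inner ℝ Y Z : ℝ) : ℂ) -
      ((inner ℝ X Y : ℝ) : ℂ) * η x Z := by
  rw [metricWedge, val3_sum, ← hθ.parseval, ← hθ.parseval, Finset.mul_sum, Finset.sum_mul,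
    ← Finset.sum_sub_distrib]
  refine Finset.sum_congr rfl fun p _ => ?_
  rw [val3_add, val3_tmul, val3_tmul, val2_tmul, val2_tmul]
  change _ + _ * -(η x Z) = _
  ring

variable {ι : Type*} (D : CoframeData n M ι)

theorem CoframeData.coe_root_mul_root (α : ι) :
    ((D.root α * D.root α : SmoothFun n M) : M → ℂ) = fun y => D.root α y * D.root α y := rfl

theorem CoframeData.sum_dFun_root_mul_root [Fintype ι] :
    ∑ α, dFun (D.root α * D.root α) = 0 := by
  rw [← map_sum]
  have h : ∑ α, D.root α * D.root α = 1 := Subtype.ext <| funext fun y => by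
    change evalFun y (∑ α, D.root α * D.root α) = 1
    rw [map_sum]
    change ∑ α, D.root α y * D.root α y = 1
    simp only [D.root_mul_root]
    rw [← Complex.ofReal_sum, D.sum_φ, Complex.ofReal_one]
  rw [h, dFun_one]

/-- The coefficients of the local expression of `A` on the chart domain `U_α`. -/
def CoframeData.localCoeff (α : ι) (x : M) (ρ μ σ : Fin n) : ℝ :=
  1 / 2 * (-pd (D.chart α) σ (gLow (D.chart α) μ ρ) x +
      pd (D.chart α) μ (gLow (D.chart α) ρ σ) x +
      pd (D.chart α) ρ (gLow (D.chart α) σ μ) x) -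
    ∑ j, pd (D.chart α) μ (D.B α j ρ) x * D.B α j σ x

/-- The contribution of the chart `U_α` to `A`. The remainder is linear in `dφ_α`, so that it
disappears from the sum over `α`. -/
theorem CoframeData.ev3_connForm_fixed (hθ : IsParsevalFrame θ)
    (hex : ∀ η : OneForm n M, ∃ u : universalForms n M, piU u = η) (α : ι) (x : M) :
    ev3 x (connForm fun j => D.frame (α, j)) +
        (1 / 2 : ℂ) • ev3 x (metricWedge θ (dFun (D.root α * D.root α))) =
      (D.φ α x : ℂ) • ∑ ρ, ∑ μ, ∑ σ, ((D.localCoeff α x ρ μ σ : ℝ) : ℂ) •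
        ((coordForm (D.chart α) ρ x ⊗ₜ[ℂ] coordForm (D.chart α) μ x) ⊗ₜ[ℂ]
          cotDagger (coordForm (D.chart α) σ x)) := by
  by_cases h0 : D.φ α x = 0
  -- at a zero of `φ_α`, possibly outside the chart, both terms on the left vanish: the forms of the
  -- frame do, and so does the differential of a square at a zero of its root
  · have hroot : D.root α x = 0 := by
      change ((√(D.φ α x) : ℝ) : ℂ) = 0
      simp [h0]
    have hframe : ∀ j, D.frame (α, j) x = 0 := fun j => ContinuousLinearMap.ext fun v => by
      simp [D.frame_apply, h0]
    have hd : dFun (D.root α * D.root α) x = 0 := by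
      refine cot_ext_coordVec (chartAt_mem x) (mem_chart_source _ x) fun ρ => ?_
      have h1 := formComp_dFun (chartAt_mem x) (mem_chart_source _ x) (D.root α * D.root α) ρ
      have h2 : DiffInChart (chartAt (EuclideanSpace ℝ (Fin n)) x) (D.root α) x :=
        diffInChart_of_contMDiffAt (chartAt_mem x) (mem_chart_source _ x) ((D.root α).2 x)
      rw [D.coe_root_mul_root, pd_mul h2 h2 (mem_chart_source _ x), hroot] at h1
      rw [formComp] at h1
      rw [h1]
      simp
    refine tensor3_ext fun X Y Z => ?_
    have hr := hθ.val3_metricWedge (dFun (D.root α * D.root α)) X Y Z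
    have hW := fun X Y Z => val3_tensorW (x := x) (fun j => D.frame (α, j)) X Y Z
    have hA := val3_connForm (x := x) (fun j => D.frame (α, j)) X Y Z
    simp only [hframe, hW, hd] at hA hr
    unfold val3 at hA hr
    rw [map_add, map_smul, map_smul, hA, hr, h0]
    simp
  -- elsewhere the components in the chart `U_α` are compared
  have hx := D.mem_source_of_ne_zero h0
  have hχ := D.chart_mem α
  refine tensor3_ext_coord hχ hx fun ρ μ σ => ?_
  have hA := val3_connForm_coordVec (θ := fun j => D.frame (α, j)) hχ hx hex
    (fun j v => by simp [D.frame_apply, D.conj_coframe hx]) ρ μ σ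
  have hr := hθ.val3_metricWedge (dFun (D.root α * D.root α)) (coordVec (D.chart α) ρ x)
    (coordVec (D.chart α) μ x) (coordVec (D.chart α) σ x)
  have hs : DiffInChart (D.chart α) (D.root α) x :=
    diffInChart_of_contMDiffAt hχ hx ((D.root α).2 x)
  have hdφ : ∀ ρ, dFun (D.root α * D.root α) x (coordVec (D.chart α) ρ x) =
      2 * (D.root α x * pd (D.chart α) ρ (D.root α) x) := fun ρ => by
    have h1 := formComp_dFun hχ hx (D.root α * D.root α) ρ
    rw [D.coe_root_mul_root, pd_mul hs hs hx, formComp] at h1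
    rw [h1]
    ring
  have hg : ∀ μ σ ρ, pd (D.chart α) ρ (fun y => ∑ j, formComp (D.chart α) (D.frame (α, j)) μ y *
        formComp (D.chart α) (D.frame (α, j)) σ y) x =
      2 * (D.root α x * pd (D.chart α) ρ (D.root α) x) * ((gLow (D.chart α) μ σ x : ℝ) : ℂ) +
        (D.φ α x : ℂ) * ((pd (D.chart α) ρ (gLow (D.chart α) μ σ) x : ℝ) : ℂ) := by
    intro μ σ ρ
    have h1 : (fun y => ∑ j, formComp (D.chart α) (D.frame (α, j)) μ y *
        formComp (D.chart α) (D.frame (α, j)) σ y) = fun y =>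
        (D.root α y * D.root α y) * ((gLow (D.chart α) μ σ y : ℝ) : ℂ) := funext fun y => by
      rw [D.root_mul_root]
      exact D.sum_frame_fixed α _ _
    have h2 : DiffInChart (D.chart α) (gLow (D.chart α) μ σ) x :=
      diffInChart_of_contMDiffAt hχ hx (contMDiffAt_gLow hχ hx μ σ)
    have h3 : DiffInChart (D.chart α) (fun y => ((gLow (D.chart α) μ σ y : ℝ) : ℂ)) x :=
      Complex.ofRealCLM.differentiableAt.comp _ h2
    have h4 : pd (D.chart α) ρ (fun y => ((gLow (D.chart α) μ σ y : ℝ) : ℂ)) x =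
        ((pd (D.chart α) ρ (gLow (D.chart α) μ σ) x : ℝ) : ℂ) := pd_clm_comp Complex.ofRealCLM h2 ρ
    rw [h1, pd_mul (hs.mul hs) h3 hx, pd_mul hs hs hx, h4, D.root_mul_root]
    ring
  have hBB : ∑ j, (D.B α j ρ x : ℂ) * (D.B α j σ x : ℂ) =
      ((gLow (D.chart α) ρ σ x : ℝ) : ℂ) := by
    simp only [← D.coframe_coordVec hx]
    exact D.parseval_coframe hx _ _
  have hframe : ∀ j σ, formComp (D.chart α) (D.frame (α, j)) σ x =
      D.root α x * (D.B α j σ x : ℂ) := fun j σ => by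
    rw [← D.coframe_coordVec hx]
    rfl
  have hS : ∑ j, pd (D.chart α) μ (formComp (D.chart α) (D.frame (α, j)) ρ) x *
        formComp (D.chart α) (D.frame (α, j)) σ x =
      D.root α x * pd (D.chart α) μ (D.root α) x * ((gLow (D.chart α) ρ σ x : ℝ) : ℂ) +
        (D.φ α x : ℂ) * ∑ j, ((pd (D.chart α) μ (D.B α j ρ) x : ℝ) : ℂ) * (D.B α j σ x : ℂ) := by
    rw [← hBB, ← D.root_mul_root, Finset.mul_sum, Finset.mul_sum, ← Finset.sum_add_distrib]
    refine Finset.sum_congr rfl fun j _ => ?_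
    have h1 : formComp (D.chart α) (D.frame (α, j)) ρ =ᶠ[nhds x]
        fun y => D.root α y * (D.B α j ρ y : ℂ) := by
      filter_upwards [(D.chart α).open_source.mem_nhds hx] with y hy
      rw [← D.coframe_coordVec hy]
      rfl
    have h2 : DiffInChart (D.chart α) (D.B α j ρ) x := diffInChart_of_contMDiffAt hχ hx
      ((D.B_smooth α j ρ).contMDiffAt ((D.chart α).open_source.mem_nhds hx))
    have h3 : DiffInChart (D.chart α) (fun y => (D.B α j ρ y : ℂ)) x :=
      Complex.ofRealCLM.differentiableAt.comp _ h2
    have h4 : pd (D.chart α) μ (fun y => (D.B α j ρ y : ℂ)) x =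
        ((pd (D.chart α) μ (D.B α j ρ) x : ℝ) : ℂ) := pd_clm_comp Complex.ofRealCLM h2 μ
    rw [pd_congr hx h1, pd_mul hs h3 hx, h4, hframe]
    ring
  -- the sign comes from `(dx^σ)^† = -dx^σ`
  have hT : evalTriple (coordVec (D.chart α) ρ x) (coordVec (D.chart α) μ x)
      (coordVec (D.chart α) σ x) (∑ ρ, ∑ μ, ∑ σ, ((D.localCoeff α x ρ μ σ : ℝ) : ℂ) •
        ((coordForm (D.chart α) ρ x ⊗ₜ[ℂ] coordForm (D.chart α) μ x) ⊗ₜ[ℂ]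
          cotDagger (coordForm (D.chart α) σ x))) = -((D.localCoeff α x ρ μ σ : ℝ) : ℂ) := by
    have hdag : ∀ σ', cotDagger (coordForm (D.chart α) σ' x) (coordVec (D.chart α) σ x) =
        if σ' = σ then -1 else 0 := fun σ' => by
      change -conj (coordForm (D.chart α) σ' x (coordVec (D.chart α) σ x)) = _
      rw [coordForm_coordVec hχ hx]
      split_ifs <;> simp
    simp [hdag, coordForm_coordVec hχ hx]
  rw [hg, hg, hg, hS] at hA
  rw [hdφ, hdφ] at hr
  unfold val3 at hA hr
  rw [map_add, map_smul, map_smul, hT, hA, hr]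
  simp only [CoframeData.localCoeff, smul_eq_mul]
  change _ + (1 / 2 : ℂ) * (_ * ((gLow (D.chart α) μ σ x : ℝ) : ℂ) -
    ((gLow (D.chart α) ρ μ x : ℝ) : ℂ) * _) = _
  rw [gLow_symm σ μ, gLow_symm μ ρ]
  push_cast
  ring

/-- The local expression of `A`, summed over the charts: the remainders are linear in `dφ_α`, and
these differentials sum to `d 1 = 0`. -/
theorem CoframeData.ev3_connForm [Fintype ι] (x : M) :
    ev3 x (connForm D.frame) =
      ∑ α, (D.φ α x : ℂ) • ∑ ρ, ∑ μ, ∑ σ, ((D.localCoeff α x ρ μ σ : ℝ) : ℂ) •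
        ((coordForm (D.chart α) ρ x ⊗ₜ[ℂ] coordForm (D.chart α) μ x) ⊗ₜ[ℂ]
          cotDagger (coordForm (D.chart α) σ x)) := by
  have h1 : connForm D.frame = ∑ α, connForm fun j => D.frame (α, j) := by
    have hW : tensorW D.frame = ∑ α, tensorW fun j => D.frame (α, j) := by
      simp only [tensorW, Fintype.sum_prod_type]
    simp only [connForm, hW, map_sum, Finset.sum_nsmul, Finset.sum_add_distrib]
  have h2 : ∑ α, ev3 x (metricWedge D.frame (dFun (D.root α * D.root α))) = 0 := by
    refine tensor3_ext fun X Y Z => ?_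
    have h3 : ∀ Z : TangentSpace (𝓡 n) x, ∑ α, dFun (D.root α * D.root α) x Z = 0 := fun Z => by
      have h4 := congrArg (fun η => ev1 x η Z) D.sum_dFun_root_mul_root
      simp only [map_sum, map_zero, sum_apply] at h4
      exact h4
    have h5 : ∀ α, evalTriple X Y Z (ev3 x (metricWedge D.frame (dFun (D.root α * D.root α)))) =
        _ := fun α => D.isParsevalFrame.val3_metricWedge (dFun (D.root α * D.root α)) X Y Z
    rw [map_sum]
    simp only [h5, Finset.sum_sub_distrib, ← Finset.sum_mul, ← Finset.mul_sum, h3]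
    simp
  rw [h1, map_sum, ← Finset.sum_congr rfl fun α _ =>
    D.ev3_connForm_fixed D.isParsevalFrame D.exists_piU_eq α x, Finset.sum_add_distrib,
    ← Finset.smul_sum, h2, smul_zero, add_zero]

end LocalForm

/-! ### Comparison with the classical Levi-Civita connection -/

section Classical

variable {n : ℕ} {M : Type*} [TopologicalSpace M] [ChartedSpace (EuclideanSpace ℝ (Fin n)) M]
  [IsManifold (𝓡 n) ∞ M] [Bundle.RiemannianBundle (fun x : M => TangentSpace (𝓡 n) x)]
  [IsContMDiffRiemannianBundle (𝓡 n) ∞ (EuclideanSpace ℝ (Fin n))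
    (fun x : M => TangentSpace (𝓡 n) x)]
variable {x : M} {χ : OpenPartialHomeomorph M (EuclideanSpace ℝ (Fin n))}
variable {cov : CovariantDerivative (𝓡 n) (EuclideanSpace ℝ (Fin n))
  (fun x : M => TangentSpace (𝓡 n) x)}

theorem mdifferentiableAt_coordVec (hχ : χ ∈ IsManifold.maximalAtlas (𝓡 n) ∞ M)
    (hx : x ∈ χ.source) (μ : Fin n) :
    MDifferentiableAt (𝓡 n) ((𝓡 n).prod 𝓘(ℝ, EuclideanSpace ℝ (Fin n)))
      (fun y => Bundle.TotalSpace.mk' (EuclideanSpace ℝ (Fin n)) y (coordVec χ μ y)) x :=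
  (contMDiffAt_coordVec hχ hx μ).mdifferentiableAt (by simp)

/-- A form applied to a differentiable vector field is differentiable. -/
theorem mdifferentiableAt_oneForm_apply (η : OneForm n M) {X : ∀ x : M, TangentSpace (𝓡 n) x}
    (hX : MDifferentiableAt (𝓡 n) ((𝓡 n).prod 𝓘(ℝ, EuclideanSpace ℝ (Fin n)))
      (fun y => Bundle.TotalSpace.mk' (EuclideanSpace ℝ (Fin n)) y (X y)) x) :
    MDifferentiableAt (𝓡 n) 𝓘(ℝ, ℂ) (fun y => η y (X y)) x := by
  have h := MDifferentiableAt.clm_bundle_apply (F₁ := EuclideanSpace ℝ (Fin n)) (F₂ := ℂ)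
    (E₁ := fun y : M => TangentSpace (𝓡 n) y) (E₂ := Bundle.Trivial M ℂ) (b := fun y : M => y)
    ((η.smooth x).mdifferentiableAt (by simp)) hX
  rw [mdifferentiableAt_section] at h
  simpa using! h

/-- The Koszul formula on coordinate vector fields. -/
theorem inner_cov_coordVec (hχ : χ ∈ IsManifold.maximalAtlas (𝓡 n) ∞ M) (hx : x ∈ χ.source)
    (hcov : IsClassicalLeviCivita n M cov) (ρ μ ν : Fin n) :
    inner ℝ (cov (coordVec χ μ) x (coordVec χ ρ x)) (coordVec χ ν x) =
      (1 / 2) * (pd χ ρ (gLow χ μ ν) x + pd χ μ (gLow χ ρ ν) x - pd χ ν (gLow χ ρ μ) x) := by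
  have : IsContMDiffRiemannianBundle (𝓡 n) 1 (EuclideanSpace ℝ (Fin n))
      (fun x : M => TangentSpace (𝓡 n) x) := .of_le (n := ∞) (by simp)
  obtain ⟨ht, hm⟩ := hcov
  have hd := fun μ => mdifferentiableAt_coordVec hχ hx μ
  have hsymm : ∀ ρ μ, cov (coordVec χ μ) x (coordVec χ ρ x) =
      cov (coordVec χ ρ) x (coordVec χ μ x) := fun ρ μ => by
    have h := cov.torsion_eq_zero_iff.1 ht (hd ρ) (hd μ)
    rw [mlieBracket_coordVec hχ hx] at h
    exact sub_eq_zero.1 h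
  have hmetric : ∀ ρ μ ν, pd χ ρ (gLow χ μ ν) x =
      inner ℝ (cov (coordVec χ μ) x (coordVec χ ρ x)) (coordVec χ ν x) +
        inner ℝ (cov (coordVec χ ν) x (coordVec χ ρ x)) (coordVec χ μ x) := fun ρ μ ν => by
    have h := hm.mvfderiv_inner_eq (coordVec χ ρ) (hd μ) (hd ν)
    rw [← mvfderiv_coordVec hχ hx ((contMDiffAt_gLow hχ hx μ ν).mdifferentiableAt (by simp)) ρ]
    rw [real_inner_comm (coordVec χ μ x)]
    exact h
  rw [hmetric, hmetric, hmetric, hsymm ν ρ, hsymm ν μ, hsymm μ ρ]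
  ring

theorem cot_apply_eq_sum_gUp (hχ : χ ∈ IsManifold.maximalAtlas (𝓡 n) ∞ M) (hx : x ∈ χ.source)
    (η : CotC n x) (v : TangentSpace (𝓡 n) x) :
    η v = ∑ σ, ∑ τ, (gUp χ σ τ x : ℂ) *
      (((inner ℝ v (coordVec χ σ x) : ℝ) : ℂ) * η (coordVec χ τ x)) := by
  have h := sum_onb_eq_gUp hχ hx (Complex.ofRealCLM.comp (innerSL ℝ v)) η
  rw [cot_eq_sum_onb η v]
  simpa [real_inner_comm] using h

/-- The Koszul formula, contracted with the inverse metric: the covariant derivatives of coordinate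
vector fields are given by the Christoffel symbols. -/
theorem oneForm_cov_coordVec (hχ : χ ∈ IsManifold.maximalAtlas (𝓡 n) ∞ M) (hx : x ∈ χ.source)
    (hcov : IsClassicalLeviCivita n M cov) (η : CotC n x) (ρ μ : Fin n) :
    η (cov (coordVec χ μ) x (coordVec χ ρ x)) =
      ∑ τ, η (coordVec χ τ x) * ((christoffel χ τ ρ μ x : ℝ) : ℂ) := by
  rw [cot_apply_eq_sum_gUp hχ hx, Finset.sum_comm]
  refine Finset.sum_congr rfl fun τ _ => ?_
  rw [christoffel]
  push_cast
  rw [Finset.mul_sum, Finset.mul_sum]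
  refine Finset.sum_congr rfl fun σ _ => ?_
  rw [inner_cov_coordVec hχ hx hcov, gUp_symm τ σ, gLow_symm σ μ, gLow_symm σ ρ]
  push_cast
  ring

/-- `X ↦ Y(η(X)) - η(∇_Y X)` is tensorial in `X`. -/
theorem tensorialAt_dual_cov (cov : CovariantDerivative (𝓡 n) (EuclideanSpace ℝ (Fin n))
    (fun x : M => TangentSpace (𝓡 n) x)) (η : OneForm n M) (Y : TangentSpace (𝓡 n) x) :
    TensorialAt (𝓡 n) (EuclideanSpace ℝ (Fin n))
      (fun X : ∀ y : M, TangentSpace (𝓡 n) y =>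
        mvfderiv (𝓡 n) (fun y => η y (X y)) x Y - η x (cov X x Y)) x where
  smul {f σ} hf hσ := by
    have h1 : (fun y => η y ((f • σ) y)) = f • fun y => η y (σ y) := funext fun y => by simp
    rw [h1, mvfderiv_smul hf (mdifferentiableAt_oneForm_apply η hσ),
      cov.isCovariantDerivativeOnUniv.leibniz hσ hf]
    simp
    ring
  add {σ σ'} hσ hσ' := by
    have h1 : (fun y => η y ((σ + σ') y)) = (fun y => η y (σ y)) + fun y => η y (σ' y) :=
      funext fun y => by simp
    rw [h1, mvfderiv_add (mdifferentiableAt_oneForm_apply η hσ)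
      (mdifferentiableAt_oneForm_apply η hσ'), cov.isCovariantDerivativeOnUniv.add hσ hσ']
    simp
    ring

/-- `∇^v - α(A)` is dual to the classical Levi-Civita connection. Both sides are linear in `Y` and
tensorial in `X`, so that the comparison may be made on coordinate vector fields. -/
theorem IsParsevalFrame.evalPair_connection {κ : Type*} [Fintype κ] {θ : κ → OneForm n M}
    (hθ : IsParsevalFrame θ) (hex : ∀ η : OneForm n M, ∃ u : universalForms n M, piU u = η)
    (hcov : IsClassicalLeviCivita n M cov) (η : OneForm n M)
    {X : ∀ x : M, TangentSpace (𝓡 n) x}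
    (hX : MDifferentiableAt (𝓡 n) ((𝓡 n).prod 𝓘(ℝ, EuclideanSpace ℝ (Fin n)))
      (fun y => Bundle.TotalSpace.mk' (EuclideanSpace ℝ (Fin n)) y (X y)) x)
    (Y : TangentSpace (𝓡 n) x) :
    evalPair (X x) Y (ev2 x (grassmann θ η - alphaR (connForm θ) η)) =
      mvfderiv (𝓡 n) (fun y => η y (X y)) x Y - η x (cov X x Y) := by
  set t := ev2 x (grassmann θ η - alphaR (connForm θ) η) with ht
  have hχ := chartAt_mem (n := n) x
  have hx := mem_chart_source (EuclideanSpace ℝ (Fin n)) x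
  set χ := chartAt (EuclideanSpace ℝ (Fin n)) x
  have h1 : ∀ ρ, evalPairLeft t (coordVec χ ρ x) =
      (TensorialAt.mkHom _ x (tensorialAt_dual_cov cov η (coordVec χ ρ x))).toLinearMap :=
    fun ρ => (coordBasis hχ hx).ext fun μ => by
      rw [coordBasis_apply]
      have h2 := TensorialAt.mkHom_apply (tensorialAt_dual_cov cov η (coordVec χ ρ x))
        (mdifferentiableAt_coordVec hχ hx μ)
      refine Eq.trans ?_ h2.symm
      rw [oneForm_cov_coordVec hχ hx hcov, mvfderiv_coordVec hχ hx
        (mdifferentiableAt_oneForm_apply η (mdifferentiableAt_coordVec hχ hx μ))]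
      exact hθ.val2_connection hχ hx hex η μ ρ
  have h3 : evalPairRight t (X x) =
      (mvfderiv (𝓡 n) (fun y => η y (X y)) x - (η x).comp (cov X x) : CotC n x).toLinearMap :=
    (coordBasis hχ hx).ext fun ρ => by
      rw [coordBasis_apply]
      refine (congrArg (fun T : TangentSpace (𝓡 n) x →ₗ[ℝ] ℂ => T (X x)) (h1 ρ)).trans ?_
      exact TensorialAt.mkHom_apply (tensorialAt_dual_cov cov η (coordVec χ ρ x)) hX
  exact congrArg (fun T : TangentSpace (𝓡 n) x →ₗ[ℝ] ℂ => T Y) h3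

end Classical

end RiemannianCalculus
end

theorem mainTheorem5 {n : ℕ} {M : Type*} [TopologicalSpace M]
    [ChartedSpace (EuclideanSpace ℝ (Fin n)) M] [IsManifold (𝓡 n) ∞ M] [T2Space M] [CompactSpace M]
    [Bundle.RiemannianBundle (fun x : M => TangentSpace (𝓡 n) x)]
    [IsContMDiffRiemannianBundle (𝓡 n) ∞ (EuclideanSpace ℝ (Fin n))
      (fun x : M => TangentSpace (𝓡 n) x)]
    {ι : Type*} [Fintype ι] (D : CoframeData n M ι) :
    -- two- and three-tensors are determined by their values at points
    (∀ t : T2 n M, (∀ x, ev2 x t = 0) → t = 0) ∧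
    (∀ t : T3 n M, (∀ x, ev3 x t = 0) → t = 0) ∧
    -- the `ω_{jα}` form a frame
    (∀ η : OneForm n M, ∑ p, pairing (D.frame p) η • D.frame p = η) ∧
    -- the explicit formula for `A = (1 + 4PQ)(W)`
    (∀ x : M, ev3 x (connForm D.frame) =
      ∑ α, (D.φ α x : ℂ) • ∑ ρ, ∑ μ, ∑ σ,
        (((1 / 2 * (-pd (D.chart α) σ (gLow (D.chart α) μ ρ) x +
              pd (D.chart α) μ (gLow (D.chart α) ρ σ) x +
              pd (D.chart α) ρ (gLow (D.chart α) σ μ) x) -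
            ∑ j, pd (D.chart α) μ (D.B α j ρ) x * D.B α j σ x : ℝ) : ℂ)) •
          ((coordForm (D.chart α) ρ x ⊗ₜ[ℂ] coordForm (D.chart α) μ x) ⊗ₜ[ℂ]
            cotDagger (coordForm (D.chart α) σ x))) ∧
    -- `A` is the connection form of the unique Levi-Civita connection
    (∀ nabla : OneForm n M →ₗ[ℂ] T2 n M, IsLeviCivita nabla ↔
      ∀ η, nabla η = grassmann D.frame η - alphaR (connForm D.frame) η) ∧
    -- the local expression
    (∀ χ ∈ IsManifold.maximalAtlas (𝓡 n) ∞ M, ∀ η : OneForm n M, ∀ x ∈ χ.source,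
      ev2 x (grassmann D.frame η - alphaR (connForm D.frame) η) =
        (∑ ν, ∑ ρ, pd χ ρ (formComp χ η ν) x •
          (coordForm χ ν x ⊗ₜ[ℂ] coordForm χ ρ x)) -
        ∑ ν, ∑ μ, ∑ ρ, (formComp χ η ν x * (christoffel χ ν μ ρ x : ℂ)) •
          (coordForm χ ρ x ⊗ₜ[ℂ] coordForm χ μ x)) ∧
    -- it is the classical Levi-Civita connection, dualised to one-forms
    (∀ cov : CovariantDerivative (𝓡 n) (EuclideanSpace ℝ (Fin n))
        (fun x : M => TangentSpace (𝓡 n) x),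
      IsClassicalLeviCivita n M cov →
      ∀ (η : OneForm n M) (X : ∀ x : M, TangentSpace (𝓡 n) x) (x : M)
        (_ : MDifferentiableAt (𝓡 n) ((𝓡 n).prod 𝓘(ℝ, EuclideanSpace ℝ (Fin n)))
          (fun y => Bundle.TotalSpace.mk' (EuclideanSpace ℝ (Fin n)) y (X y)) x)
        (Y : TangentSpace (𝓡 n) x),
        evalPair (X x) Y (ev2 x (grassmann D.frame η - alphaR (connForm D.frame) η)) =
          mvfderiv (𝓡 n) (fun y => η y (X y)) x Y - η x (cov X x Y)) := by
  have hθ := D.isParsevalFrame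
  have hex := D.exists_piU_eq
  refine ⟨fun t ht => hθ.tensor2_eq_zero fun x X Y => by simp [val2, ht],
    fun t ht => hθ.tensor3_eq_zero fun x X Y Z => by simp [val3, ht],
    hθ.sum_pairing_smul, D.ev3_connForm, hθ.isLeviCivita_iff hex, ?_,
    fun cov hcov η X x hX Y => hθ.evalPair_connection hex hcov η hX Y⟩
  intro χ hχ η x hx
  refine tensor2_ext_coord hχ hx fun a b => ?_
  refine (hθ.val2_connection hχ hx hex η a b).trans ?_
  simp only [map_sub, map_sum, map_smul, evalPair_tmul, coordForm_coordVec hχ hx]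
  simp
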